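/- **Setting.** Let $D\subset\mathbb R^d$ be open and connected. Consider $$Au(x)=\tfrac12\operatorname{Tr}(\mathbf Q(x)\nabla^2u(x))+b(x)\cdot\nabla u(x)+\int_{\mathbb R^d}\Big(u(x+y)-u(x)-\frac{y\cdot\nabla u(x)}{1+|y|^2}\Big)N(x,dy),$$ where $\mathbf Q,b$ are Borel measurable and are bounded on $D$, $\mathbf Q(x)$ is non-negative definite for $x\in D$, and $N$ is a kernel of measures on $\mathbb R^d\setminus\{0\}$ with $\sup_{x\in\mathbb R^d}\int\min\{1,|y|^2\}N(x,dy)<\infty$. Let $(P_x)_{x\in\mathbb R^d}$ be a strong Markovian solution of the martingale problem for $A$ on the space of càdlàg paths in $\mathbb R^d$: $x\mapsto P_x$ is measurable; the canonical process $(X_t)$ is strongly Markovian for its natural filtration $(\mathcal F_t)$ and $(P_x)$; and for every Borel probability measure $\mu$, and in particular for $\mu=\delta_x$ with $P_\mu=P_x$, under $P_\mu=\int P_x\,\mu(dx)$ the variable $X_0$ has law $\mu$ and for each $f\in C^2_b(\mathbb R^d)$ the process $f(X_t)-f(X_0)-\int_0^tAf(X_r)\,dr$ is a (well-defined) martingale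 with respect to $(\mathcal F_t)$. Let $\tau_D=\inf\{t>0: X_t\notin D\}$ and assume $P_x[\tau_D<\infty]=1$ for all $x\in D$. Let $c:D\to[0,\infty)$ be bounded and Borel, and let $m$ be a $\sigma$-finite Borel measure, non-trivial on $D$. Put $e_c(t)=\exp\{-\int_0^tc(X_r)\,dr\}$, let $v_{c,D}(x)=\mathbb E_xe_c(\tau_D)$ be the gauge function, and let $R^D_1f(x)=\mathbb E_x\int_0^{\tau_D}e^{-t}f(X_t)\,dt$. Let $\mathcal S(D)=\bigcup_{x\in D}(x+\operatorname{supp}N(x,\cdot))$, $D_S=D\cup\partial D\cup(\mathcal S(D)\setminus D)$ and $\bar u_{D_S}=\sup_{D_S}u$. For a Borel function $g\le0$ on $D$, a bounded Borel function $u:\mathbb R^d\to\mathbb R$ is a weak subsolution of $(-A+c)v=g$ in $D$ if $$u(x)\le\mathbb E_x\big[e_c(\tau_D\wedge t)u(X_{\tau_D\wedge t})\big]+\mathbb E_x\Big[\int_0^{\tau_D\wedge t}e_c(r)g(X_r)\,dr\Big],\qquad x\in D,\ t\ge0.$$ **Theorem 3.8.** Assume IR$_m$): $R^D_1f(x)>0$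 for all $x\in D$ and all bounded non-negative Borel functions $f$ on $D$ with $\int_Df\,dm>0$. Then there exist a Borel function $\psi_{D,A}:D\to(0,\infty)$ and a Borel measure $\nu_{D,A}$ on $D$ with $m\ll\nu_{D,A}$ (on $D$), which may depend on $c$ but not on $g$ or $u$, such that for every Borel $g\le 0$ on $D$, every weak subsolution $u$ of $(-A+c)v=g$ in $D$ with $\bar u_{D_S}\ge0$ satisfies $$\bar u_{D_S}-u(x)\ge\psi_{D,A}(x)\Big\{\bar u_{D_S}\int_Dc\,v_{c,D}\,d\nu_{D,A}+\int_Dg^-\,d\nu_{D,A}\Big\},\qquad x\in D,$$ where $g^-=\max\{-g,0\}$ (the right-hand side is computed in $[0,\infty]$ with $0\cdot\infty=0$). If moreover A3') $\int_Dc\,dm>0$ holds, then the quantitative Hopf lemma (Corollary 3.10) holds: there is a Borel function $\psi:D\to(0,\infty)$ such that for every Borel $g\le0$ on $D$ and every weak subsolution $u$ of $(-A+c)v=g$ in $D$ (with no sign condition on $\bar u_{D_S}$), $\bar u_{D_S}-u(x)\ge\bar u_{D_S}\,\psi(x)$ for all $x\in D$. -/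

import Mathlib

open MeasureTheory ProbabilityTheory Filter Topology
open scoped ENNReal NNReal

noncomputable section

namespace NonlocalHopf

/-- Euclidean space of dimension `d`, with the Euclidean norm. -/
abbrev Rd (d : ℕ) : Type := EuclideanSpace ℝ (Fin d)

/-! ### The integro-differential operator -/

/-- Coefficients of the operator: the matrix `Q`, the drift `b` and the Levy kernel `N`. -/
structure LevyOp (d : ℕ) where
  Q : Rd d → Matrix (Fin d) (Fin d) ℝ
  b : Rd d → Rd d
  N : Kernel (Rd d) (Rd d)

namespace LevyOp

variable {d : ℕ}

/-- `A f (x) = (1/2) Tr (Q(x) ∇²f(x)) + b(x) · ∇f(x)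
  + ∫ (f(x+y) - f(x) - y · ∇f(x) / (1 + |y|²)) N(x, dy)`. -/
def apply (A : LevyOp d) (f : Rd d → ℝ) (x : Rd d) : ℝ :=
  (1 / 2) * (∑ i, ∑ j, A.Q x i j *
      fderiv ℝ (fderiv ℝ f) x (EuclideanSpace.single i 1) (EuclideanSpace.single j 1))
    + fderiv ℝ f x (A.b x)
    + ∫ y, (f (x + y) - f x - fderiv ℝ f x y / (1 + ‖y‖ ^ 2)) ∂(A.N x)

/-- The diffusion matrix and the drift are Borel, bounded on `D`, and the matrix is
non-negative definite at each point of `D`. -/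
structure CondA1 (A : LevyOp d) (D : Set (Rd d)) : Prop where
  measurable_Q : ∀ i j, Measurable fun x => A.Q x i j
  measurable_b : Measurable A.b
  bounded_Q : ∃ K : ℝ, ∀ x ∈ D, ∀ i j, |A.Q x i j| ≤ K
  bounded_b : ∃ K : ℝ, ∀ x ∈ D, ‖A.b x‖ ≤ K
  nonneg_Q : ∀ x ∈ D, ∀ ξ : Rd d, 0 ≤ ∑ i, ∑ j, A.Q x i j * ξ i * ξ j

/-- `N(x, ·)` is carried by `ℝᵈ \ {0}` and `sup_x ∫ min {1, |y|²} N(x, dy) < ∞`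
(this makes each `N(x, ·)` sigma-finite). -/
structure CondA2 (A : LevyOp d) : Prop where
  no_atom_zero : ∀ x, A.N x {0} = 0
  bounded : ∃ K : ℝ≥0, ∀ x, ∫⁻ y, ENNReal.ofReal (min 1 (‖y‖ ^ 2)) ∂(A.N x) ≤ K

/-- The range of non-locality over `D`: the union over `x ∈ D` of `x + supp N(x, ·)`. -/
def nonlocalRange (A : LevyOp d) (D : Set (Rd d)) : Set (Rd d) :=
  ⋃ x ∈ D, (fun y => x + y) '' (A.N x).support

/-- The extended boundary `∂_S D = ∂D ∪ (S(D) \ D)`. -/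
def extBoundary (A : LevyOp d) (D : Set (Rd d)) : Set (Rd d) :=
  frontier D ∪ (A.nonlocalRange D \ D)

/-- `D_S = ∂_S D ∪ D`. -/
def extDomain (A : LevyOp d) (D : Set (Rd d)) : Set (Rd d) :=
  A.extBoundary D ∪ D

/-- The supremum of `u` over `D_S`. -/
def supDS (A : LevyOp d) (D : Set (Rd d)) (u : Rd d → ℝ) : ℝ :=
  sSup (u '' A.extDomain D)

end LevyOp

/-- `C²` functions on `ℝᵈ` that are bounded together with their first two derivatives. -/
def IsCb2 {d : ℕ} (f : Rd d → ℝ) : Prop :=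
  ContDiff ℝ 2 f ∧ ∃ K : ℝ, ∀ x,
    |f x| ≤ K ∧ ‖fderiv ℝ f x‖ ≤ K ∧ ‖fderiv ℝ (fderiv ℝ f) x‖ ≤ K

/-! ### Path space -/

/-- Cadlag paths `[0, ∞) → ℝᵈ`. -/
structure CadlagPath (d : ℕ) where
  toFun : ℝ≥0 → Rd d
  right_cont : ∀ t, ContinuousWithinAt toFun (Set.Ici t) t
  left_lim : ∀ t, ∃ l, Tendsto toFun (𝓝[<] t) (𝓝 l)

namespace CadlagPath

variable {d : ℕ}

instance : CoeFun (CadlagPath d) (fun _ => ℝ≥0 → Rd d) := ⟨CadlagPath.toFun⟩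

/-- The sigma-algebra generated by the canonical process `X_t(ω) = ω(t)`; it is the Borel
sigma-algebra of the Skorokhod topology. -/
instance : MeasurableSpace (CadlagPath d) :=
  ⨆ t : ℝ≥0, MeasurableSpace.comap (fun ω : CadlagPath d => ω t) inferInstance

/-- The natural filtration `F_t = σ(X_s, s ≤ t)` of the canonical process. -/
def filt (d : ℕ) : Filtration ℝ≥0 (inferInstance : MeasurableSpace (CadlagPath d)) where
  seq t := ⨆ s ≤ t, MeasurableSpace.comap (fun ω : CadlagPath d => ω s) inferInstance
  mono' _ _ hst := biSup_mono fun _ hr => hr.trans hst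
  le' _ := iSup₂_le fun s _ =>
    le_iSup (fun s : ℝ≥0 => MeasurableSpace.comap (fun ω : CadlagPath d => ω s) inferInstance) s

/-- The shift `(θ_t ω)(s) = ω(t + s)`. -/
def shift (t : ℝ≥0) (ω : CadlagPath d) : CadlagPath d where
  toFun s := ω (t + s)
  right_cont s := by
    have h : ContinuousWithinAt (fun r : ℝ≥0 => t + r) (Set.Ici s) s :=
      (continuous_const.add continuous_id).continuousWithinAt
    exact (ω.right_cont (t + s)).comp h
      (fun r (hr : s ≤ r) => show t + s ≤ t + r from add_le_add_right hr t)
  left_lim s := by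
    obtain ⟨l, hl⟩ := ω.left_lim (t + s)
    refine ⟨l, hl.comp ?_⟩
    refine tendsto_nhdsWithin_iff.2 ⟨?_, ?_⟩
    · exact ((continuous_const.add continuous_id).tendsto s).mono_left nhdsWithin_le_nhds
    · filter_upwards [self_mem_nhdsWithin] with r hr
      exact show t + r < t + s from add_lt_add_right hr t

/-- The exit time `τ_D = inf {t > 0 : X_t ∉ D}`, with `inf ∅ = ∞`. -/
def exitTime (D : Set (Rd d)) (ω : CadlagPath d) : ℝ≥0∞ :=
  ⨅ (t : ℝ≥0) (_ : 0 < t ∧ ω t ∉ D), (t : ℝ≥0∞)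

/-- `τ_D ∧ t`, as a finite time. -/
def exitTimeMin (D : Set (Rd d)) (ω : CadlagPath d) (t : ℝ≥0) : ℝ≥0 :=
  (min (exitTime D ω) (t : ℝ≥0∞)).toNNReal

/-- `∫_0^T c(X_r) dr` for a non-negative `c` and `T ∈ [0, ∞]`. -/
def cumul (c : Rd d → ℝ) (ω : CadlagPath d) (T : ℝ≥0∞) : ℝ≥0∞ :=
  ∫⁻ r in {r : ℝ | 0 ≤ r ∧ ENNReal.ofReal r < T}, ENNReal.ofReal (c (ω r.toNNReal))

open Classical in
/-- `e_c(T) = exp (-∫_0^T c(X_r) dr)` for `T ∈ [0, ∞]`, with `exp (-∞) = 0`. -/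
def discount (c : Rd d → ℝ) (ω : CadlagPath d) (T : ℝ≥0∞) : ℝ :=
  if cumul c ω T = ⊤ then 0 else Real.exp (-(cumul c ω T).toReal)

end CadlagPath

/-! ### Strong Markovian solutions of the martingale problem -/

section MartingaleProblem

variable {d : ℕ}

/-- `M_t[f] = f(X_t) - f(X_0) - ∫_0^t A f(X_r) dr`. -/
def mgProcess (A : LevyOp d) (f : Rd d → ℝ) (t : ℝ≥0) (ω : CadlagPath d) : ℝ :=
  f (ω t) - f (ω 0) - ∫ r in (0 : ℝ)..t, A.apply f (ω r.toNNReal)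

/-- `Pμ` is a probability measure on path space solving the martingale problem for `A` with
initial distribution `μ`. That the time integral in `M_t[f]` exists is part of the definition
(it is automatic when the coefficients are bounded on the whole space). -/
structure IsMartingaleSolution (A : LevyOp d) (μ : Measure (Rd d)) (Pμ : Measure (CadlagPath d)) :
    Prop where
  prob : IsProbabilityMeasure Pμ
  initial : Pμ.map (fun ω => ω 0) = μ
  integrable : ∀ f, IsCb2 f → ∀ᵐ ω ∂Pμ, ∀ t : ℝ≥0,
    IntervalIntegrable (fun r : ℝ => A.apply f (ω r.toNNReal)) volume 0 t
  martingale : ∀ f, IsCb2 f → Martingale (mgProcess A f) (CadlagPath.filt d) Pμ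

/-- The canonical process is strongly Markovian for the natural filtration and the family `P`:
for each stopping time `σ`, on `{σ < ∞}`, the conditional law of the shifted path `θ_σ ω` given
`F_σ` is `P_{X_σ}`. -/
def IsStrongMarkov (P : Kernel (Rd d) (CadlagPath d)) : Prop :=
  ∀ (x : Rd d) (σ : CadlagPath d → WithTop ℝ≥0) (hσ : IsStoppingTime (CadlagPath.filt d) σ)
    (B C : Set (CadlagPath d)), MeasurableSet[hσ.measurableSpace] B → MeasurableSet C →
    P x (B ∩ {ω | σ ω ≠ ⊤ ∧ CadlagPath.shift (σ ω).untopA ω ∈ C}) =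
      ∫⁻ ω in B ∩ {ω | σ ω ≠ ⊤}, P (ω (σ ω).untopA) C ∂(P x)

/-- A strong Markovian solution `(P_x)` of the martingale problem associated with `A`.
Measurability of `x ↦ P_x(C)` is part of `P` being a kernel, and `μ.bind P` is
`∫ P_x μ(dx)`. -/
structure IsStrongMarkovSolution (A : LevyOp d) (P : Kernel (Rd d) (CadlagPath d)) : Prop where
  solution : ∀ x, IsMartingaleSolution A (Measure.dirac x) (P x)
  strongMarkov : IsStrongMarkov P
  mixture : ∀ μ : Measure (Rd d), IsProbabilityMeasure μ →
    IsMartingaleSolution A μ (μ.bind P)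

end MartingaleProblem

/-! ### Functions on the domain, resolvent, gauge function, weak subsolutions -/

section Analytic

variable {d : ℕ}

/-- `f` is Borel measurable on `D`. -/
def BorelOn (D : Set (Rd d)) (f : Rd d → ℝ) : Prop := Measurable fun x : D => f x

/-- `f` restricted to `D` is a bounded non-negative Borel function. -/
def IsBbPlus (D : Set (Rd d)) (f : Rd d → ℝ) : Prop :=
  BorelOn D f ∧ (∀ x ∈ D, 0 ≤ f x) ∧ ∃ K : ℝ, ∀ x ∈ D, f x ≤ K

/-- The exit time from `D` is a.s. finite for all starting points in `D`. -/
def CondET (P : Kernel (Rd d) (CadlagPath d)) (D : Set (Rd d)) : Prop :=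
  ∀ x ∈ D, ∀ᵐ ω ∂(P x), CadlagPath.exitTime D ω < ⊤

/-- The resolvent `R^D_α f(x) = E_x ∫_0^{τ_D} e^{-α t} f(X_t) dt` for non-negative `f`. -/
def resolventD (P : Kernel (Rd d) (CadlagPath d)) (D : Set (Rd d)) (α : ℝ) (f : Rd d → ℝ)
    (x : Rd d) : ℝ≥0∞ :=
  ∫⁻ ω, (∫⁻ t in {t : ℝ | 0 ≤ t ∧ ENNReal.ofReal t < CadlagPath.exitTime D ω},
    ENNReal.ofReal (Real.exp (-α * t) * f (ω t.toNNReal))) ∂(P x)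

/-- The resolvent is `m`-irreducible: `R^D_1 f > 0` at all points of `D` for each bounded
non-negative Borel `f` on `D` with `∫_D f dm > 0`. -/
def CondIR (P : Kernel (Rd d) (CadlagPath d)) (D : Set (Rd d)) (m : Measure (Rd d)) : Prop :=
  ∀ f : Rd d → ℝ, IsBbPlus D f → 0 < ∫⁻ x in D, ENNReal.ofReal (f x) ∂m →
    ∀ x ∈ D, 0 < resolventD P D 1 f x

/-- The gauge function `v_{c,D}(x) = E_x e_c(τ_D)`. -/
def gaugeFn (P : Kernel (Rd d) (CadlagPath d)) (D : Set (Rd d)) (c : Rd d → ℝ) (x : Rd d) : ℝ :=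
  ∫ ω, CadlagPath.discount c ω (CadlagPath.exitTime D ω) ∂(P x)

/-- `E_x [e_c(τ_D ∧ t) u(X_{τ_D ∧ t})]`. -/
def stoppedMean (P : Kernel (Rd d) (CadlagPath d)) (D : Set (Rd d)) (c u : Rd d → ℝ)
    (x : Rd d) (t : ℝ≥0) : ℝ :=
  ∫ ω, CadlagPath.discount c ω (CadlagPath.exitTimeMin D ω t) *
    u (ω (CadlagPath.exitTimeMin D ω t)) ∂(P x)

/-- `E_x ∫_0^{τ_D ∧ t} e_c(r) h(X_r) dr` for non-negative `h`. -/
def sourceMean (P : Kernel (Rd d) (CadlagPath d)) (D : Set (Rd d)) (c h : Rd d → ℝ)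
    (x : Rd d) (t : ℝ≥0) : ℝ≥0∞ :=
  ∫⁻ ω, (∫⁻ r in {r : ℝ | 0 ≤ r ∧ ENNReal.ofReal r < CadlagPath.exitTimeMin D ω t},
    ENNReal.ofReal (CadlagPath.discount c ω (ENNReal.ofReal r) * h (ω r.toNNReal))) ∂(P x)

/-- Weak subsolutions of `(-A + c) v = g` in `D`, for `g ≤ 0`: bounded Borel functions `u` on
`ℝᵈ` with `u(x) ≤ E_x [e_c(τ_D ∧ t) u(X_{τ_D ∧ t})] + E_x ∫_0^{τ_D ∧ t} e_c(r) g(X_r) dr` for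
all `x ∈ D` and `t ≥ 0`. As `g = -g⁻`, the last term is minus an expectation in `[0, ∞]`, and the
inequality is read in the extended reals. -/
structure IsWeakSubsolution (P : Kernel (Rd d) (CadlagPath d)) (D : Set (Rd d))
    (c g u : Rd d → ℝ) : Prop where
  measurable : Measurable u
  bounded : ∃ K : ℝ, ∀ x, |u x| ≤ K
  le : ∀ x ∈ D, ∀ t : ℝ≥0,
    (u x : EReal) ≤ (stoppedMean P D c u x t : EReal)
      - ((sourceMean P D c (fun y => max (-g y) 0) x t : ℝ≥0∞) : EReal)

/-- The quantitative Hopf lemma for subsolutions of `(-A + c) v = g`, with the function `ψ`. -/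
def QuantHopf (A : LevyOp d) (P : Kernel (Rd d) (CadlagPath d)) (D : Set (Rd d))
    (c g ψ : Rd d → ℝ) : Prop :=
  ∀ u, IsWeakSubsolution P D c g u →
    ∀ x ∈ D, A.supDS D u * ψ x ≤ A.supDS D u - u x

end Analytic

end NonlocalHopf

end

open NonlocalHopf

/-!
Write `w = sup u - u` for the deficit of a weak subsolution with `sup u ≥ 0` over `D_S`, `T` for
the exit time, and let `c ≤ C` on `D`. Two consequences of the subsolution inequality at a
deterministic time `t` suffice. Since `1 - e^{-a} ≥ a e^{-a}`,
`w(x) ≥ e^{-C t} E_x ∫_0^{T ∧ t} h(X_r) dr` with `h = (sup u) c + g⁻`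
(`IsWeakSubsolution.occ_le_deficit`), and `w(x) ≥ e^{-C t} E_x [w(X_t); t < T]`
(`IsWeakSubsolution.killed_le_deficit`). Averaging over `t` with weight `e^{-t}` turns them into
`R w ≤ w` and `R h ≤ const * w` for the killed resolvent `R = R^D_{C+1}`
(`IsWeakSubsolution.lintegral_deficit_le`, `IsWeakSubsolution.lintegral_source_le`), so that
`w` dominates a multiple of `R⁴ h`.

Irreducibility says that every measure `R(x, ·)`, `x ∈ D`, dominates `m`. Hence `R` has a jointly
measurable density with respect to `m` (normalised to a probability measure on `D`) that is
positive almost everywhere, so it is bounded below outside a set of small product measure. By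
Fubini this bounds the density of `R²` below on a product `A × B` of sets of positive measure.
Then `R⁴ ≥ ψ ⊗ ν` with `ψ` a multiple of `R(·, A)`, positive on `D`, and
`ν = ∫_B R(y, ·) m(dy)`, which dominates `m` (`exists_minorization`).

Two facts about the process make this rigorous, and both come from Dynkin's formula at optional
times, that is, from optional sampling for right-continuous martingales. The first is that the exit
time is almost surely the limit `innerExit` of the times at which the process comes close to the
complement of `D`: a function vanishing near the complement has no jump in expectation at that limit
(`IsMartingaleSolution.exitTime_ae_eq`). As `innerExit` is measurable, so is, up to null sets,
everything built from the exit time. The second is that the process, stopped at the exit time, does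
not see values of `u` above its supremum over `D_S`, because the intensity of jumps from `D` into a
compact set disjoint from `D_S` vanishes (`IsMartingaleSolution.apply_eval_innerExit_le`).
-/

namespace NonlocalHopf

section

/-! ### Optional sampling for right-continuous martingales -/

/-- The first point of the grid `(n + 1)⁻¹ ℕ` strictly after `s`. -/
noncomputable def gridNext (n : ℕ) (s : ℝ≥0) : ℝ≥0 := (⌊(n + 1 : ℝ≥0) * s⌋₊ + 1) / (n + 1)

lemma le_gridNext (n : ℕ) (s : ℝ≥0) : s ≤ gridNext n s := by
  rw [gridNext, le_div_iff₀ (by positivity), mul_comm]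
  exact (Nat.lt_floor_add_one _).le

lemma tendsto_gridNext (s : ℝ≥0) : Tendsto (fun n => gridNext n s) atTop (𝓝[≥] s) := by
  refine tendsto_nhdsWithin_iff.2 ⟨?_, Eventually.of_forall fun n => le_gridNext n s⟩
  have hub : Tendsto (fun n : ℕ => s + 1 / ((n : ℝ≥0) + 1)) atTop (𝓝 s) := by
    simpa using tendsto_const_nhds.add (tendsto_one_div_add_atTop_nhds_zero_nat (𝕜 := ℝ≥0))
  refine tendsto_of_tendsto_of_tendsto_of_le_of_le tendsto_const_nhds hub
    (fun n => le_gridNext n s) fun n => ?_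
  rw [gridNext, add_div]
  gcongr
  rw [div_le_iff₀ (by positivity), mul_comm]
  exact Nat.floor_le (by positivity)

/-- The first point of the grid `(n + 1)⁻¹ ℕ` strictly after `s`, capped at `t`. -/
noncomputable def gridTime (t : ℝ≥0) (n : ℕ) (s : ℝ≥0) : ℝ≥0 := min t (gridNext n s)

lemma gridTime_le (t : ℝ≥0) (n : ℕ) (s : ℝ≥0) : gridTime t n s ≤ t := min_le_left _ _

lemma tendsto_gridTime {t s : ℝ≥0} (hs : s ≤ t) :
    Tendsto (fun n => gridTime t n s) atTop (𝓝[≥] s) := by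
  refine tendsto_nhdsWithin_iff.2
    ⟨?_, Eventually.of_forall fun n => le_min hs (le_gridNext n s)⟩
  have h := (tendsto_const_nhds (x := t)).min ((tendsto_gridNext s).mono_right nhdsWithin_le_nhds)
  rwa [min_eq_right hs] at h

lemma countable_range_gridTime {Ω : Type*} (t : ℝ≥0) (n : ℕ) (σ : Ω → ℝ≥0) :
    (Set.range fun ω => ((gridTime t n (σ ω) : ℝ≥0) : WithTop ℝ≥0)).Countable := by
  refine (Set.countable_range fun j : ℕ =>
    ((min t (((j : ℝ≥0) + 1) / (n + 1)) : ℝ≥0) : WithTop ℝ≥0)).mono ?_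
  rintro _ ⟨ω, rfl⟩
  exact ⟨⌊(n + 1 : ℝ≥0) * σ ω⌋₊, rfl⟩

variable {Ω : Type*} {mΩ : MeasurableSpace Ω}

/-- A random time is optional if `{σ < s}` is known at time `s`. For a filtration that is not
right-continuous this is weaker than being a stopping time. -/
def IsOptionalTime (ℱ : Filtration ℝ≥0 mΩ) (σ : Ω → ℝ≥0) : Prop :=
  ∀ s, MeasurableSet[ℱ s] {ω | σ ω < s}

lemma IsOptionalTime.isStoppingTime_gridTime {ℱ : Filtration ℝ≥0 mΩ} {σ : Ω → ℝ≥0}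
    (h : IsOptionalTime ℱ σ) (t : ℝ≥0) (n : ℕ) :
    IsStoppingTime ℱ fun ω => ((gridTime t n (σ ω) : ℝ≥0) : WithTop ℝ≥0) := by
  intro s
  simp only [WithTop.coe_le_coe]
  by_cases hts : t ≤ s
  · convert MeasurableSet.univ using 1
    exact Set.eq_univ_of_forall fun ω => (gridTime_le t n _).trans hts
  · set j : ℕ := ⌊(n + 1 : ℝ≥0) * s⌋₊ with hj
    have hpos : (0 : ℝ≥0) < n + 1 := by positivity
    have hjs : (j : ℝ≥0) / (n + 1) ≤ s := by
      rw [div_le_iff₀ hpos, mul_comm]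
      exact Nat.floor_le (by positivity)
    convert ℱ.mono hjs _ (h ((j : ℝ≥0) / (n + 1))) using 1
    ext ω
    simp only [Set.mem_ofPred_eq, gridTime, gridNext, min_le_iff, hts, false_or]
    rw [div_le_iff₀ hpos, mul_comm s, lt_div_iff₀ hpos, mul_comm (σ ω),
      ← Nat.floor_lt (by positivity), ← Nat.add_one_le_iff, hj, Nat.le_floor_iff (by positivity)]
    push_cast
    rfl

variable {μ : Measure Ω}

/-- By Fatou's lemma, the pointwise limits of the sequences in a uniformly integrable double family
form a uniformly integrable family. -/
lemma uniformIntegrable_of_tendsto_ae {ι : Type*} {f : ι → ℕ → Ω → ℝ} {g : ι → Ω → ℝ}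
    (hf : UniformIntegrable (fun p : ι × ℕ => f p.1 p.2) 1 μ)
    (hlim : ∀ i, ∀ᵐ ω ∂μ, Tendsto (fun n => f i n ω) atTop (𝓝 (g i ω))) :
    UniformIntegrable g 1 μ := by
  obtain ⟨hm, hu, C, hC⟩ := hf
  refine ⟨fun i => aestronglyMeasurable_of_tendsto_ae atTop (fun n => hm (i, n)) (hlim i), ?_, C, ?_⟩
  · intro ε hε
    obtain ⟨δ, hδ, h⟩ := hu hε
    refine ⟨δ, hδ, fun i s hs hμs => ?_⟩
    refine (Lp.eLpNorm_lim_le_liminf_eLpNorm (fun n => (hm (i, n)).indicator hs) _ ?_).trans ?_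
    · filter_upwards [hlim i] with ω hω
      by_cases hωs : ω ∈ s
      · simpa [hωs] using hω
      · simp [hωs]
    · exact liminf_le_of_le (by isBoundedDefault)
        fun b hb => by
          obtain ⟨n, hn⟩ := hb.exists
          exact hn.trans (h (i, n) s hs hμs)
  · intro i
    refine (Lp.eLpNorm_lim_le_liminf_eLpNorm (fun n => hm (i, n)) _ (hlim i)).trans ?_
    exact liminf_le_of_le (by isBoundedDefault)
        fun b hb => by
          obtain ⟨n, hn⟩ := hb.exists
          exact hn.trans (hC (i, n))

variable {ℱ : Filtration ℝ≥0 mΩ} {M : ℝ≥0 → Ω → ℝ}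

lemma tendsto_gridTime_of_rightCont
    (hrc : ∀ᵐ ω ∂μ, ∀ s, ContinuousWithinAt (fun r => M r ω) (Set.Ici s) s) {σ : Ω → ℝ≥0} {t : ℝ≥0}
    (hσt : ∀ ω, σ ω ≤ t) :
    ∀ᵐ ω ∂μ, Tendsto (fun n => M (gridTime t n (σ ω)) ω) atTop (𝓝 (M (σ ω) ω)) := by
  filter_upwards [hrc] with _ hω
  exact (hω _).tendsto.comp (tendsto_gridTime (hσt _))

variable [IsProbabilityMeasure μ]

/-- Optional sampling on a grid, where the random time has countable range. -/
lemma gridTime_ae_eq_condExp (hM : Martingale M ℱ μ) {σ : Ω → ℝ≥0} (hσ : IsOptionalTime ℱ σ)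
    (t : ℝ≥0) (n : ℕ) :
    (fun ω => M (gridTime t n (σ ω)) ω) =ᵐ[μ]
      μ[M t | (hσ.isStoppingTime_gridTime t n).measurableSpace] :=
  hM.stoppedValue_ae_eq_condExp_of_le_const_of_countable_range (hσ.isStoppingTime_gridTime t n)
    (fun _ => WithTop.coe_le_coe.2 (gridTime_le t n _)) (countable_range_gridTime t n σ)

lemma uniformIntegrable_gridTime (hM : Martingale M ℱ μ) {ι : Type*} {σ : ι → Ω → ℝ≥0}
    (hσ : ∀ i, IsOptionalTime ℱ (σ i)) (t : ℝ≥0) :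
    UniformIntegrable (fun (p : ι × ℕ) ω => M (gridTime t p.2 (σ p.1 ω)) ω) 1 μ := by
  have h := (hM.integrable t).uniformIntegrable_condExp (ι := ι × ℕ)
    (ℱ := fun p => ((hσ p.1).isStoppingTime_gridTime t p.2).measurableSpace)
    (fun p => ((hσ p.1).isStoppingTime_gridTime t p.2).measurableSpace_le)
  exact h.ae_eq fun p => (gridTime_ae_eq_condExp hM (hσ p.1) t p.2).symm

/-- The values of a right-continuous martingale at optional times bounded by a fixed time are
uniformly integrable. -/
lemma uniformIntegrable_optional (hM : Martingale M ℱ μ)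
    (hrc : ∀ᵐ ω ∂μ, ∀ s, ContinuousWithinAt (fun r => M r ω) (Set.Ici s) s)
    {ι : Type*} {σ : ι → Ω → ℝ≥0} (hσ : ∀ i, IsOptionalTime ℱ (σ i)) {t : ℝ≥0}
    (hσt : ∀ i ω, σ i ω ≤ t) :
    UniformIntegrable (fun i ω => M (σ i ω) ω) 1 μ :=
  uniformIntegrable_of_tendsto_ae (f := fun i n ω => M (gridTime t n (σ i ω)) ω)
    (uniformIntegrable_gridTime hM hσ t) fun i => tendsto_gridTime_of_rightCont hrc (hσt i)

lemma integrable_optional (hM : Martingale M ℱ μ)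
    (hrc : ∀ᵐ ω ∂μ, ∀ s, ContinuousWithinAt (fun r => M r ω) (Set.Ici s) s)
    {σ : Ω → ℝ≥0} (hσ : IsOptionalTime ℱ σ) {t : ℝ≥0} (hσt : ∀ ω, σ ω ≤ t) :
    Integrable (fun ω => M (σ ω) ω) μ :=
  memLp_one_iff_integrable.1 <|
    (uniformIntegrable_optional hM hrc (ι := Unit) (fun _ => hσ) fun _ => hσt).memLp ()

/-- Optional sampling for a right-continuous martingale at a bounded optional time. -/
lemma integral_optional (hM : Martingale M ℱ μ)
    (hrc : ∀ᵐ ω ∂μ, ∀ s, ContinuousWithinAt (fun r => M r ω) (Set.Ici s) s)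
    {σ : Ω → ℝ≥0} (hσ : IsOptionalTime ℱ σ) {t : ℝ≥0} (hσt : ∀ ω, σ ω ≤ t) :
    ∫ ω, M (σ ω) ω ∂μ = ∫ ω, M t ω ∂μ := by
  have hui := uniformIntegrable_gridTime hM (ι := Unit) (fun _ => hσ) t
  have hint := integrable_optional hM hrc hσ hσt
  have hL := tendsto_Lp_finite_of_tendsto_ae le_rfl ENNReal.one_ne_top
    (fun n => hui.1 ((), n)) (memLp_one_iff_integrable.2 hint)
    (fun ε hε => (hui.2.1 hε).imp fun δ h => h.imp fun _ h n s => h ((), n) s)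
    (tendsto_gridTime_of_rightCont hrc hσt)
  have h1 := tendsto_integral_of_L1' _ hint.1
    (Eventually.of_forall fun n => memLp_one_iff_integrable.1 (hui.memLp ((), n))) hL
  refine tendsto_nhds_unique h1 ?_
  refine tendsto_const_nhds.congr fun n => ?_
  rw [integral_congr_ae (gridTime_ae_eq_condExp hM hσ t n),
    integral_condExp (hσ.isStoppingTime_gridTime t n).measurableSpace_le]

end

section

/-! ### Exit times approximated from inside -/

namespace CadlagPath

variable {d : ℕ}

lemma measurable_eval_filt {s t : ℝ≥0} (h : s ≤ t) :
    Measurable[filt d t] fun ω : CadlagPath d => ω s := by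
  intro B hB
  exact (le_iSup₂_of_le (f := fun (s : ℝ≥0) (_ : s ≤ t) =>
    MeasurableSpace.comap (fun ω : CadlagPath d => ω s) inferInstance) s h le_rfl :
    MeasurableSpace.comap (fun ω : CadlagPath d => ω s) inferInstance ≤ _) _ ⟨B, hB, rfl⟩

lemma measurable_eval (s : ℝ≥0) : Measurable fun ω : CadlagPath d => ω s :=
  (measurable_eval_filt le_rfl).mono ((filt d).le s) le_rfl

lemma measurable_eval_prod : Measurable fun p : CadlagPath d × ℝ≥0 => p.1 p.2 := by
  refine measurable_of_tendsto_metrizable (f := fun n (p : CadlagPath d × ℝ≥0) =>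
    p.1 (gridNext n p.2)) (fun n => ?_) (tendsto_pi_nhds.2 fun p =>
      (p.1.right_cont p.2).tendsto.comp (tendsto_gridNext p.2))
  have h1 : Measurable fun q : CadlagPath d × ℕ => q.1 (((q.2 : ℝ≥0) + 1) / (n + 1)) :=
    measurable_from_prod_countable_left fun j =>
      measurable_eval (((j : ℝ≥0) + 1) / (n + 1))
  have h2 : Measurable fun p : CadlagPath d × ℝ≥0 => (p.1, ⌊(n + 1 : ℝ≥0) * p.2⌋₊) :=
    measurable_fst.prodMk (Nat.measurable_floor.comp (measurable_snd.const_mul _))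
  exact h1.comp h2

lemma measurable_eval_comp {α : Type*} [MeasurableSpace α] {f : α → CadlagPath d} {g : α → ℝ≥0}
    (hf : Measurable f) (hg : Measurable g) : Measurable fun a => f a (g a) :=
  measurable_eval_prod.comp (hf.prodMk hg)

lemma measurable_eval_at {σ : CadlagPath d → ℝ≥0} (hσ : Measurable σ) :
    Measurable fun ω : CadlagPath d => ω (σ ω) :=
  measurable_eval_comp measurable_id hσ

lemma exists_gt_of_mem_isOpen (ω : CadlagPath d) {O : Set (Rd d)} (hO : IsOpen O) {t : ℝ≥0}
    (ht : ω t ∈ O) : ∃ u > t, ∀ r ∈ Set.Ico t u, ω r ∈ O :=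
  (mem_nhdsGE_iff_exists_Ico_subset).1 ((ω.right_cont t).preimage_mem_nhdsWithin (hO.mem_nhds ht))

/-- The first time at which the path is closer than `1 / (k + 1)` to the complement of `D`. -/
noncomputable def nearTime (D : Set (Rd d)) (k : ℕ) (ω : CadlagPath d) : ℝ≥0∞ :=
  ⨅ (t : ℝ≥0) (_ : ω t ∈ Metric.thickening (1 / (k + 1 : ℝ)) Dᶜ), (t : ℝ≥0∞)

/-- The supremum of the times at which the path comes close to the complement of `D`. Unlike the
exit time, it is measurable for trivial reasons; it can be smaller than the exit
time, when the path has a left limit outside `D` but jumps back into `D`. -/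
noncomputable def innerExit (D : Set (Rd d)) (ω : CadlagPath d) : ℝ≥0∞ := ⨆ k, nearTime D k ω

variable {D : Set (Rd d)} {k : ℕ} {ω : CadlagPath d}

lemma nearTime_le {t : ℝ≥0} (h : ω t ∈ Metric.thickening (1 / (k + 1 : ℝ)) Dᶜ) :
    nearTime D k ω ≤ t := by
  unfold nearTime
  exact iInf₂_le t h

lemma le_nearTime {a : ℝ≥0∞} (h : ∀ t : ℝ≥0, ω t ∈ Metric.thickening (1 / (k + 1 : ℝ)) Dᶜ → a ≤ t) :
    a ≤ nearTime D k ω := by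
  unfold nearTime
  exact le_iInf₂ h

/-- Right-continuity lets a path enter an open set along a fixed countable dense set of times. -/
lemma nearTime_lt_iff {a : ℝ≥0∞} : nearTime D k ω < a ↔
    ∃ j, (TopologicalSpace.denseSeq ℝ≥0 j : ℝ≥0∞) < a ∧
      ω (TopologicalSpace.denseSeq ℝ≥0 j) ∈ Metric.thickening (1 / (k + 1 : ℝ)) Dᶜ := by
  constructor
  · intro h
    simp only [nearTime, iInf_lt_iff] at h
    obtain ⟨t, ht, hta⟩ := h
    obtain ⟨u, hu, hr⟩ := ω.exists_gt_of_mem_isOpen Metric.isOpen_thickening ht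
    obtain ⟨v, hv, hva⟩ : ∃ v : ℝ≥0, t < v ∧ (v : ℝ≥0∞) ≤ a := by
      obtain ⟨v, h1, h2⟩ := ENNReal.lt_iff_exists_nnreal_btwn.1 hta
      exact ⟨v, by exact_mod_cast h1, h2.le⟩
    obtain ⟨j, hj⟩ := (TopologicalSpace.denseRange_denseSeq ℝ≥0).exists_mem_open
      (isOpen_Ioo (a := t) (b := min u v)) (Set.nonempty_Ioo.2 (lt_min hu hv))
    refine ⟨j, lt_of_lt_of_le ?_ hva, hr _ ⟨hj.1.le, hj.2.trans_le (min_le_left _ _)⟩⟩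
    exact_mod_cast hj.2.trans_le (min_le_right _ _)
  · rintro ⟨j, h1, h2⟩
    exact (nearTime_le h2).trans_lt h1

lemma measurableSet_nearTime_lt (k : ℕ) (s : ℝ≥0) :
    MeasurableSet[filt d s] {ω | nearTime D k ω < s} := by
  simp only [nearTime_lt_iff, Set.ofPred_exists]
  refine MeasurableSet.iUnion fun j => ?_
  by_cases hj : (TopologicalSpace.denseSeq ℝ≥0 j : ℝ≥0∞) < s
  · simp only [hj, true_and]
    exact measurable_eval_filt (by exact_mod_cast hj.le) Metric.isOpen_thickening.measurableSet
  · simp [hj]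

lemma measurable_nearTime (k : ℕ) : Measurable (nearTime (d := d) D k) := by
  refine measurable_of_Iio fun a => ?_
  change MeasurableSet {ω | nearTime D k ω < a}
  simp only [nearTime_lt_iff, Set.ofPred_exists]
  refine MeasurableSet.iUnion fun j => ?_
  by_cases hj : (TopologicalSpace.denseSeq ℝ≥0 j : ℝ≥0∞) < a
  · simp only [hj, true_and]
    exact measurable_eval _ Metric.isOpen_thickening.measurableSet
  · simp [hj]

lemma measurable_innerExit : Measurable (innerExit (d := d) D) :=
  Measurable.iSup fun k => measurable_nearTime k

lemma nearTime_mono (D : Set (Rd d)) (ω : CadlagPath d) : Monotone fun k => nearTime D k ω := by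
  intro k l hkl
  refine le_nearTime fun t ht => nearTime_le (Metric.thickening_mono ?_ _ ht)
  gcongr

lemma measurableSet_innerExit_lt (s : ℝ≥0) :
    MeasurableSet[filt d s] {ω | innerExit D ω < s} := by
  have : {ω | innerExit (d := d) D ω < s} = ⋃ j, {ω | (TopologicalSpace.denseSeq ℝ≥0 j) < s ∧
      ∀ k, nearTime D k ω < TopologicalSpace.denseSeq ℝ≥0 j} := by
    ext ω
    simp only [Set.mem_ofPred_eq, Set.mem_iUnion]
    constructor
    · intro h
      obtain ⟨v, h1, h2⟩ := ENNReal.lt_iff_exists_nnreal_btwn.1 h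
      obtain ⟨j, hj⟩ := (TopologicalSpace.denseRange_denseSeq ℝ≥0).exists_mem_open
        (isOpen_Ioo (a := v) (b := s)) (Set.nonempty_Ioo.2 (by exact_mod_cast h2))
      refine ⟨j, hj.2, fun k => (le_iSup (fun k => nearTime D k ω) k).trans_lt (h1.trans ?_)⟩
      exact_mod_cast hj.1
    · rintro ⟨j, h1, h2⟩
      exact (iSup_le fun k => (h2 k).le).trans_lt (by exact_mod_cast h1)
  rw [this]
  refine MeasurableSet.iUnion fun j => ?_
  by_cases hj : (TopologicalSpace.denseSeq ℝ≥0 j) < s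
  · simp only [hj, true_and, Set.ofPred_forall]
    exact MeasurableSet.iInter fun k => (filt d).mono hj.le _ (measurableSet_nearTime_lt k _)
  · simp [hj]

lemma mem_of_lt_nearTime {r : ℝ≥0} (h : (r : ℝ≥0∞) < nearTime D k ω) : ω r ∈ D := by
  by_contra hr
  refine absurd (nearTime_le ?_) h.not_ge
  exact Metric.self_subset_thickening (by positivity) _ hr

lemma mem_of_lt_innerExit {r : ℝ≥0} (h : (r : ℝ≥0∞) < innerExit D ω) : ω r ∈ D := by
  obtain ⟨k, hk⟩ := lt_iSup_iff.1 h
  exact mem_of_lt_nearTime hk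

lemma innerExit_le_exitTime (D : Set (Rd d)) (ω : CadlagPath d) :
    innerExit D ω ≤ exitTime D ω :=
  iSup_le fun _ => le_iInf₂ fun _ ht => nearTime_le <|
    Metric.self_subset_thickening (by positivity) _ ht.2

lemma eval_nearTime_mem {t : ℝ≥0} (h : nearTime D k ω = t) :
    ω t ∈ Metric.cthickening (1 / (k + 1 : ℝ)) Dᶜ := by
  by_contra hn
  obtain ⟨u, hu, hr⟩ := ω.exists_gt_of_mem_isOpen
    (Metric.isClosed_cthickening.isOpen_compl) (show ω t ∈ (_)ᶜ from hn)
  have : (u : ℝ≥0∞) ≤ nearTime D k ω := by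
    refine le_nearTime fun s hs => ?_
    by_contra! hsu
    have hts : t ≤ s := by exact_mod_cast h.symm.le.trans (nearTime_le hs)
    exact hr s ⟨hts, by exact_mod_cast hsu⟩ (Metric.thickening_subset_cthickening _ _ hs)
  rw [h] at this
  exact absurd hu (not_lt.2 (by exact_mod_cast this))

lemma exists_notMem_cthickening (hD : IsOpen D) {x : Rd d} (hx : x ∈ D) :
    ∃ k : ℕ, x ∉ Metric.cthickening (1 / (k + 1 : ℝ)) Dᶜ := by
  obtain ⟨ε, hε, hb⟩ := Metric.isOpen_iff.1 hD x hx
  obtain ⟨k, hk⟩ := exists_nat_one_div_lt hε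
  refine ⟨k, fun h => ?_⟩
  obtain ⟨z, hz, hxz⟩ := Metric.mem_thickening_iff.1
    (Metric.cthickening_subset_thickening' hε hk _ h)
  exact hz (hb (by rwa [Metric.mem_ball, dist_comm]))

lemma innerExit_pos (hD : IsOpen D) (h0 : ω 0 ∈ D) : 0 < innerExit D ω := by
  obtain ⟨k, hk⟩ := exists_notMem_cthickening hD h0
  refine lt_of_lt_of_le (pos_iff_ne_zero.2 fun h => hk ?_) (le_iSup (fun k => nearTime D k ω) k)
  exact eval_nearTime_mem (by simpa using h)

lemma exitTime_eq_innerExit (hD : IsOpen D) (h0 : ω 0 ∈ D) {t : ℝ≥0} (ht : innerExit D ω = t)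
    (hωt : ω t ∉ D) : exitTime D ω = innerExit D ω := by
  refine le_antisymm ?_ (innerExit_le_exitTime D ω)
  have hpos := innerExit_pos hD h0
  rw [ht] at hpos ⊢
  unfold exitTime
  exact iInf₂_le t ⟨by exact_mod_cast hpos, hωt⟩

end CadlagPath

/-- The extended time `T` capped at `t`, as a finite time. -/
noncomputable def capTime (T : ℝ≥0∞) (t : ℝ≥0) : ℝ≥0 := (min T t).toNNReal

lemma coe_capTime (T : ℝ≥0∞) (t : ℝ≥0) : (capTime T t : ℝ≥0∞) = min T t :=
  ENNReal.coe_toNNReal (ne_top_of_le_ne_top ENNReal.coe_ne_top (min_le_right _ _))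

lemma capTime_le (T : ℝ≥0∞) (t : ℝ≥0) : capTime T t ≤ t := by
  have : (capTime T t : ℝ≥0∞) ≤ t := coe_capTime T t ▸ min_le_right _ _
  exact_mod_cast this

lemma coe_capTime_le (T : ℝ≥0∞) (t : ℝ≥0) : (capTime T t : ℝ≥0∞) ≤ T :=
  coe_capTime T t ▸ min_le_left _ _

lemma capTime_of_le {T : ℝ≥0∞} {t : ℝ≥0} (h : (t : ℝ≥0∞) ≤ T) : capTime T t = t := by
  rw [capTime, min_eq_right h, ENNReal.toNNReal_coe]

lemma capTime_coe_of_le {s t : ℝ≥0} (h : s ≤ t) : capTime s t = s := by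
  rw [capTime, min_eq_left (by exact_mod_cast h), ENNReal.toNNReal_coe]

lemma isOptionalTime_capTime {Ω : Type*} {mΩ : MeasurableSpace Ω} {ℱ : Filtration ℝ≥0 mΩ}
    {T : Ω → ℝ≥0∞} (hT : ∀ s : ℝ≥0, MeasurableSet[ℱ s] {ω | T ω < s}) (t : ℝ≥0) :
    IsOptionalTime ℱ fun ω => capTime (T ω) t := by
  intro s
  have h : ∀ ω, capTime (T ω) t < s ↔ T ω < s ∨ t < s := fun ω => by
    rw [← ENNReal.coe_lt_coe, coe_capTime, min_lt_iff, ENNReal.coe_lt_coe]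
  by_cases hts : t < s
  · simp [h, hts]
  · simpa [h, hts] using hT s

end

section

open CadlagPath

/-! ### Dynkin's formula at optional times -/

variable {d : ℕ}

lemma exists_bound_fderiv {E F : Type*} [NormedAddCommGroup E] [NormedSpace ℝ E]
    [NormedAddCommGroup F] [NormedSpace ℝ F] {f : E → F} (hf : ContDiff ℝ 1 f)
    (hc : HasCompactSupport f) : ∃ K, ∀ x, ‖fderiv ℝ f x‖ ≤ K :=
  (hf.continuous_fderiv one_ne_zero).bounded_above_of_compact_support (hc.fderiv (𝕜 := ℝ))

lemma isCb2_of_hasCompactSupport {f : Rd d → ℝ} (hf : ContDiff ℝ 2 f) (hc : HasCompactSupport f) :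
    IsCb2 f :=
  have h1 : ContDiff ℝ 1 (fderiv ℝ f) := hf.fderiv_right (by norm_num)
  have ⟨K₀, hK₀⟩ := hf.continuous.bounded_above_of_compact_support hc
  have ⟨K₁, hK₁⟩ := exists_bound_fderiv (hf.of_le one_le_two) hc
  have ⟨K₂, hK₂⟩ := exists_bound_fderiv h1 (hc.fderiv (𝕜 := ℝ))
  ⟨hf, max K₀ (max K₁ K₂), fun x => ⟨(hK₀ x).trans (le_max_left _ _),
    (hK₁ x).trans ((le_max_left _ _).trans (le_max_right _ _)),
    (hK₂ x).trans ((le_max_right _ _).trans (le_max_right _ _))⟩⟩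

lemma IsOptionalTime.measurable {Ω : Type*} {mΩ : MeasurableSpace Ω} {ℱ : Filtration ℝ≥0 mΩ}
    {σ : Ω → ℝ≥0} (h : IsOptionalTime ℱ σ) : Measurable σ :=
  measurable_of_Iio fun s => ℱ.le s _ (h s)

/-- The compensator `∫_0^s A f(X_r) dr` in the martingale `M_s[f]`. -/
noncomputable def compensator (A : LevyOp d) (f : Rd d → ℝ) (s : ℝ≥0) (ω : CadlagPath d) : ℝ :=
  ∫ r in (0 : ℝ)..s, A.apply f (ω r.toNNReal)

lemma compensator_eq (A : LevyOp d) (f : Rd d → ℝ) (s : ℝ≥0) (ω : CadlagPath d) :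
    compensator A f s ω = f (ω s) - f (ω 0) - mgProcess A f s ω := by
  simp [compensator, mgProcess]

variable {A : LevyOp d} {ν : Measure (Rd d)} {μ : Measure (CadlagPath d)} {f : Rd d → ℝ}

lemma IsMartingaleSolution.continuous_compensator (h : IsMartingaleSolution A ν μ) (hf : IsCb2 f) :
    ∀ᵐ ω ∂μ, Continuous fun s => compensator A f s ω := by
  filter_upwards [h.integrable f hf] with ω hω
  refine continuous_iff_continuousAt.2 fun s => ?_
  have h0 : (0 : ℝ) ∈ Set.uIcc (0 : ℝ) ((s + 1 : ℝ≥0) : ℝ) := Set.left_mem_uIcc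
  have hc := intervalIntegral.continuousOn_primitive_interval' (hω (s + 1)) h0
  have hmem : Set.Iio (s + 1) ∈ 𝓝 s := Iio_mem_nhds (lt_add_one s)
  refine ContinuousOn.continuousAt (s := Set.Iio (s + 1)) ?_ hmem
  refine hc.comp (t := Set.uIcc (0 : ℝ) ((s + 1 : ℝ≥0) : ℝ)) NNReal.continuous_coe.continuousOn ?_
  intro r hr
  rw [Set.uIcc_of_le (NNReal.coe_nonneg _)]
  exact ⟨r.coe_nonneg, NNReal.coe_le_coe.2 (le_of_lt hr)⟩

lemma IsMartingaleSolution.continuousWithinAt_Ici_mg (h : IsMartingaleSolution A ν μ) (hf : IsCb2 f) :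
    ∀ᵐ ω ∂μ, ∀ s, ContinuousWithinAt (fun r => mgProcess A f r ω) (Set.Ici s) s := by
  filter_upwards [h.continuous_compensator hf] with ω hω s
  have h1 : ContinuousWithinAt (fun r => f (ω r)) (Set.Ici s) s :=
    (hf.1.continuous.continuousAt).comp_continuousWithinAt (ω.right_cont s)
  exact (h1.sub continuousWithinAt_const).sub hω.continuousWithinAt

lemma IsCb2.integrable_comp [IsFiniteMeasure μ] (hf : IsCb2 f) {g : CadlagPath d → Rd d}
    (hg : Measurable g) : Integrable (fun ω => f (g ω)) μ := by
  obtain ⟨K, hK⟩ := hf.2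
  exact Integrable.of_bound (hf.1.continuous.measurable.comp hg).aestronglyMeasurable K
    (Eventually.of_forall fun ω => (hK _).1)

lemma IsMartingaleSolution.integrable_compensator (h : IsMartingaleSolution A ν μ) (hf : IsCb2 f)
    {σ : CadlagPath d → ℝ≥0} (hσ : IsOptionalTime (filt d) σ) {t : ℝ≥0} (hσt : ∀ ω, σ ω ≤ t) :
    Integrable (fun ω => compensator A f (σ ω) ω) μ := by
  have := h.prob
  simp only [compensator_eq]
  exact ((hf.integrable_comp (measurable_eval_at hσ.measurable)).sub
    (hf.integrable_comp (measurable_eval 0))).sub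
    (integrable_optional (h.martingale f hf) (h.continuousWithinAt_Ici_mg hf) hσ hσt)

/-- Dynkin's formula at a bounded optional time. -/
lemma IsMartingaleSolution.dynkin (h : IsMartingaleSolution A ν μ) (hf : IsCb2 f)
    {σ : CadlagPath d → ℝ≥0} (hσ : IsOptionalTime (filt d) σ) {t : ℝ≥0} (hσt : ∀ ω, σ ω ≤ t) :
    ∫ ω, f (ω (σ ω)) ∂μ = ∫ ω, f (ω 0) ∂μ + ∫ ω, compensator A f (σ ω) ω ∂μ := by
  have := h.prob
  have hM := h.martingale f hf
  have h1 := integral_optional hM (h.continuousWithinAt_Ici_mg hf) hσ hσt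
  have h0 : ∫ ω, mgProcess A f t ω ∂μ = 0 := by
    have := hM.setIntegral_eq (zero_le : (0 : ℝ≥0) ≤ t) MeasurableSet.univ
    simp only [setIntegral_univ] at this
    rw [← this]
    simp [mgProcess]
  have hi := integrable_optional hM (h.continuousWithinAt_Ici_mg hf) hσ hσt
  have hi1 := hf.integrable_comp (μ := μ) (measurable_eval_at hσ.measurable)
  have hi0 := hf.integrable_comp (μ := μ) (measurable_eval (d := d) 0)
  simp only [compensator_eq]
  have e1 : ∫ ω, (f (ω (σ ω)) - f (ω 0) - mgProcess A f (σ ω) ω) ∂μ =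
      ∫ ω, (f (ω (σ ω)) - f (ω 0)) ∂μ - ∫ ω, mgProcess A f (σ ω) ω ∂μ :=
    integral_sub (hi1.sub hi0) hi
  rw [e1, integral_sub hi1 hi0, h1, h0]
  ring

/-- The compensators of `f` at optional times bounded by a fixed time are uniformly integrable,
even where `A f` is unbounded. -/
lemma IsMartingaleSolution.unifIntegrable_compensator (h : IsMartingaleSolution A ν μ)
    (hf : IsCb2 f) {σ : ℕ → CadlagPath d → ℝ≥0} (hσ : ∀ k, IsOptionalTime (filt d) (σ k)) {t : ℝ≥0}
    (hσt : ∀ k ω, σ k ω ≤ t) :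
    UnifIntegrable (fun k ω => compensator A f (σ k ω) ω) 1 μ := by
  have := h.prob
  obtain ⟨K, hK⟩ := hf.2
  have hK0 : 0 ≤ K := (abs_nonneg _).trans (hK 0).1
  have hint : ∀ k, Integrable (fun ω => f (ω (σ k ω)) - f (ω 0)) μ := fun k =>
    (hf.integrable_comp (measurable_eval_at (hσ k).measurable)).sub
      (hf.integrable_comp (measurable_eval 0))
  have hbdd : UnifIntegrable (fun k (ω : CadlagPath d) => f (ω (σ k ω)) - f (ω 0)) 1 μ := by
    refine unifIntegrable_of le_rfl ENNReal.one_ne_top (fun k => (hint k).1) fun ε _ =>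
      ⟨(K + K + 1).toNNReal, fun k => ?_⟩
    have : {ω : CadlagPath d | (K + K + 1).toNNReal ≤
        ‖f (ω (σ k ω)) - f (ω 0)‖₊} = ∅ := by
      refine Set.eq_empty_of_forall_notMem fun ω hω => ?_
      have h1 : K + K + 1 ≤ |f (ω (σ k ω)) - f (ω 0)| := Real.toNNReal_le_iff_le_coe.1 hω
      have h2 := abs_sub (f (ω (σ k ω))) (f (ω 0))
      linarith [(hK (ω (σ k ω))).1, (hK (ω 0)).1]
    rw [this]
    simp
  have hui := uniformIntegrable_optional (h.martingale f hf) (h.continuousWithinAt_Ici_mg hf) hσ hσt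
  refine (hbdd.sub hui.2.1 le_rfl (fun k => (hint k).1) hui.1).ae_eq fun k => ?_
  exact Eventually.of_forall fun ω => (compensator_eq A f (σ k ω) ω).symm

/-! ### The exit time under a solution of the martingale problem -/

variable {D : Set (Rd d)}

lemma isOptionalTime_nearTime (k : ℕ) (t : ℝ≥0) :
    IsOptionalTime (filt d) fun ω => capTime (nearTime D k ω) t :=
  isOptionalTime_capTime (measurableSet_nearTime_lt k) t

lemma isOptionalTime_innerExit (t : ℝ≥0) :
    IsOptionalTime (filt d) fun ω => capTime (innerExit D ω) t :=
  isOptionalTime_capTime measurableSet_innerExit_lt t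

lemma tendsto_nearTime (t : ℝ≥0) (ω : CadlagPath d) :
    Tendsto (fun k => capTime (nearTime D k ω) t) atTop (𝓝 (capTime (innerExit D ω) t)) := by
  rw [← ENNReal.tendsto_coe]
  simp only [coe_capTime]
  exact (tendsto_atTop_iSup (nearTime_mono D ω)).min tendsto_const_nhds

/-- A bounded non-negative `C²` function that vanishes near the complement of `D` vanishes at the
position of the process at the inner exit time: its expectation has no jump at that time, since
the inner exit time is approached by the optional times at which it already vanishes. -/
lemma IsMartingaleSolution.apply_eval_innerExit_eq_zero (h : IsMartingaleSolution A ν μ)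
    (hf : IsCb2 f) (hf0 : ∀ z, 0 ≤ f z) {k₀ : ℕ}
    (hfD : ∀ z ∈ Metric.cthickening (1 / (k₀ + 1 : ℝ)) Dᶜ, f z = 0) (t : ℝ≥0) :
    ∀ᵐ ω ∂μ, innerExit D ω ≤ t → f (ω (capTime (innerExit D ω) t)) = 0 := by
  have := h.prob
  obtain ⟨K, hK⟩ := hf.2
  set S : CadlagPath d → ℝ≥0 := fun ω => capTime (innerExit D ω) t with hS
  set R : ℕ → CadlagPath d → ℝ≥0 := fun k ω => capTime (nearTime D k ω) t with hR
  have hSo : IsOptionalTime (filt d) S := isOptionalTime_innerExit t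
  have hRo : ∀ k, IsOptionalTime (filt d) (R k) := fun k => isOptionalTime_nearTime k t
  have hSt : ∀ ω, S ω ≤ t := fun ω => capTime_le _ _
  have hRt : ∀ k ω, R k ω ≤ t := fun k ω => capTime_le _ _
  have hSm := hf.integrable_comp (μ := μ) (measurable_eval_at hSo.measurable)
  have hRm := fun k =>
    hf.integrable_comp (μ := μ) (measurable_eval_at (hRo k).measurable)
  have hTm : MeasurableSet {ω : CadlagPath d | innerExit D ω ≤ t} :=
    measurable_innerExit measurableSet_Iic
  have hL := tendsto_Lp_finite_of_tendsto_ae le_rfl ENNReal.one_ne_top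
    (fun k => (h.integrable_compensator hf (hRo k) (hRt k)).1)
    (memLp_one_iff_integrable.2 (h.integrable_compensator hf hSo hSt))
    (h.unifIntegrable_compensator hf hRo hRt)
    ((h.continuous_compensator hf).mono fun ω hω => (hω.tendsto _).comp (tendsto_nearTime t ω))
  have h1 := tendsto_integral_of_L1' _ (h.integrable_compensator hf hSo hSt).1
    (Eventually.of_forall fun k => h.integrable_compensator hf (hRo k) (hRt k)) hL
  -- The expected increment of `f` between the times `R k` and their limit `S` has the limit `0` by
  -- Dynkin's formula, and the limit `E[f(X_S); T ≤ t]` by pathwise inspection.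
  have h2 : Tendsto (fun k => ∫ ω, (f (ω (S ω)) - f (ω (R k ω))) ∂μ) atTop (𝓝 0) := by
    have : ∀ k, ∫ ω, (f (ω (S ω)) - f (ω (R k ω))) ∂μ =
        ∫ ω, compensator A f (S ω) ω ∂μ - ∫ ω, compensator A f (R k ω) ω ∂μ := fun k => by
      rw [integral_sub hSm (hRm k)]
      rw [h.dynkin hf hSo hSt, h.dynkin hf (hRo k) (hRt k)]
      ring
    simp only [this]
    simpa using (tendsto_const_nhds (x := ∫ ω, compensator A f (S ω) ω ∂μ)).sub h1
  set g : CadlagPath d → ℝ := {ω | innerExit D ω ≤ t}.indicator fun ω => f (ω (S ω)) with hg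
  have hgi : Integrable g μ := hSm.indicator hTm
  have h3 : Tendsto (fun k => ∫ ω, (f (ω (S ω)) - f (ω (R k ω))) ∂μ) atTop (𝓝 (∫ ω, g ω ∂μ)) := by
    refine tendsto_integral_of_dominated_convergence (fun _ => K + K)
      (fun k => (hSm.sub (hRm k)).1) (integrable_const _) (fun k => Eventually.of_forall fun ω => ?_)
      (Eventually.of_forall fun ω => ?_)
    · exact (abs_sub _ _).trans (add_le_add (hK _).1 (hK _).1)
    · by_cases hω : innerExit D ω ≤ t
      · refine tendsto_const_nhds.congr' ?_
        filter_upwards [eventually_ge_atTop k₀] with k hk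
        have hle : nearTime D k ω ≤ t := (le_iSup (fun k => nearTime D k ω) k).trans hω
        have hcoe : nearTime D k ω = (R k ω : ℝ≥0∞) := by
          rw [hR, coe_capTime, min_eq_left hle]
        have hz : f (ω (R k ω)) = 0 := by
          refine hfD _ (Metric.cthickening_mono ?_ _ (eval_nearTime_mem hcoe))
          gcongr
        simp [hg, Set.indicator_of_mem (show ω ∈ {ω | innerExit D ω ≤ t} from hω), hz]
      · refine tendsto_const_nhds.congr' ?_
        obtain ⟨k₁, hk₁⟩ := lt_iSup_iff.1 (not_le.1 hω)
        filter_upwards [eventually_ge_atTop k₁] with k hk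
        have e1 : R k ω = t := capTime_of_le (hk₁.le.trans (nearTime_mono D ω hk))
        have e2 : S ω = t := capTime_of_le (not_le.1 hω).le
        rw [e1, e2, sub_self]
        simp [hg, hω]
  have h4 : ∫ ω, g ω ∂μ = 0 := tendsto_nhds_unique h3 h2
  have hg0 : 0 ≤ g := fun ω => Set.indicator_nonneg (fun ω _ => hf0 _) ω
  filter_upwards [(integral_eq_zero_iff_of_nonneg hg0 hgi).1 h4] with ω hω hT
  simpa [hg, hT] using hω

lemma IsMartingaleSolution.eval_innerExit_notMem (h : IsMartingaleSolution A ν μ) (hD : IsOpen D)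
    (t : ℝ≥0) : ∀ᵐ ω ∂μ, innerExit D ω ≤ t → ω (capTime (innerExit D ω) t) ∉ D := by
  have hTm : MeasurableSet {ω : CadlagPath d | innerExit D ω ≤ t} :=
    measurable_innerExit measurableSet_Iic
  have hXm : Measurable fun ω : CadlagPath d => ω (capTime (innerExit D ω) t) :=
    measurable_eval_at (isOptionalTime_innerExit t).measurable
  set ρ : Measure (Rd d) := (μ.restrict {ω | innerExit D ω ≤ t}).map
    fun ω => ω (capTime (innerExit D ω) t) with hρ
  have hnull : ρ D = 0 := by
    refine measure_null_of_locally_null D fun z hz => ?_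
    obtain ⟨k₀, hk₀⟩ := exists_notMem_cthickening hD hz
    obtain ⟨f, hfs, hfc, hfd, hfr, hf1⟩ := exists_contDiff_tsupport_subset (n := 2)
      (Metric.isClosed_cthickening.isOpen_compl.mem_nhds
        (show z ∈ (Metric.cthickening (1 / (k₀ + 1 : ℝ)) Dᶜ)ᶜ from hk₀))
    refine ⟨{y | f y ≠ 0}, mem_nhdsWithin_of_mem_nhds
      ((isOpen_ne_fun hfd.continuous continuous_const).mem_nhds (by simp [hf1])), ?_⟩
    rw [hρ, Measure.map_apply hXm
      (isOpen_ne_fun hfd.continuous continuous_const).measurableSet,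
      Measure.restrict_apply (hXm (isOpen_ne_fun hfd.continuous continuous_const).measurableSet)]
    have h0 := h.apply_eval_innerExit_eq_zero (isCb2_of_hasCompactSupport hfd hfc)
      (fun y => (hfr ⟨y, rfl⟩).1)
      (fun y hy => by_contra fun hne => hfs (subset_tsupport f hne) hy) t
    rw [ae_iff] at h0
    convert h0 using 2
    ext ω
    simp [and_comm]
  rw [hρ, Measure.map_apply hXm hD.measurableSet, Measure.restrict_apply (hXm hD.measurableSet)]
    at hnull
  rw [ae_iff]
  convert hnull using 2
  ext ω
  simp [and_comm]

/-- Under a solution of the martingale problem started in `D`, the exit time agrees with the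
measurable inner exit time whenever the latter is finite. -/
lemma IsMartingaleSolution.exitTime_ae_eq (h : IsMartingaleSolution A ν μ) (hD : IsOpen D)
    (h0 : ∀ᵐ ω ∂μ, ω 0 ∈ D) : exitTime D =ᵐ[μ] innerExit D := by
  filter_upwards [h0, ae_all_iff.2 fun n : ℕ => h.eval_innerExit_notMem hD n] with ω h0 hω
  by_cases hT : innerExit D ω = ⊤
  · exact le_antisymm (hT ▸ le_top) (innerExit_le_exitTime D ω)
  · obtain ⟨s, hs⟩ := WithTop.ne_top_iff_exists.1 hT
    obtain ⟨n, hn⟩ := exists_nat_ge s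
    have hsn : innerExit D ω ≤ ((n : ℝ≥0) : ℝ≥0∞) := by rw [← hs]; exact ENNReal.coe_le_coe.2 hn
    have := hω n hsn
    rw [← hs] at this
    exact exitTime_eq_innerExit hD h0 hs.symm (capTime_coe_of_le hn ▸ this)

end

section

open CadlagPath

/-! ### The exit position lies in the extended domain -/

variable {d : ℕ} {A : LevyOp d} {D : Set (Rd d)}

/-- On an open set where `f` vanishes, only the jump part of the operator sees `f`. -/
lemma LevyOp.apply_eq_integral {f : Rd d → ℝ} (hD : IsOpen D) (hf : ∀ z ∈ D, f z = 0) {z : Rd d}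
    (hz : z ∈ D) : A.apply f z = ∫ y, f (z + y) ∂(A.N z) := by
  have h0 : f =ᶠ[𝓝 z] fun _ => 0 := by
    filter_upwards [hD.mem_nhds hz] with y hy using hf y hy
  have h1 : fderiv ℝ f =ᶠ[𝓝 z] fun _ => 0 := by
    filter_upwards [h0.fderiv (𝕜 := ℝ)] with y hy
    rw [hy]; simp
  have h2 : fderiv ℝ (fderiv ℝ f) z = 0 := by
    rw [h1.fderiv_eq]; simp
  simp [LevyOp.apply, h2, h1.eq_of_nhds, hf z hz]

lemma LevyOp.measure_tail_le {K : ℝ≥0}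
    (hK : ∀ x, ∫⁻ y, ENNReal.ofReal (min 1 (‖y‖ ^ 2)) ∂(A.N x) ≤ K) {δ : ℝ} (hδ : 0 < δ)
    (z : Rd d) : A.N z {y | δ ≤ ‖y‖} ≤ K / ENNReal.ofReal (min 1 (δ ^ 2)) := by
  have hpos : 0 < min 1 (δ ^ 2) := by positivity
  rw [ENNReal.le_div_iff_mul_le (Or.inl (ENNReal.ofReal_pos.2 hpos).ne') (Or.inl ENNReal.ofReal_ne_top),
    mul_comm]
  refine le_trans ?_ ((mul_meas_ge_le_lintegral₀ (by fun_prop)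
    (ENNReal.ofReal (min 1 (δ ^ 2)))).trans (hK z))
  gcongr with y
  intro hy
  have hy : δ ≤ ‖y‖ := hy
  gcongr

lemma LevyOp.ae_add_mem_extDomain {z : Rd d} (hz : z ∈ D) :
    ∀ᵐ y ∂(A.N z), z + y ∈ A.extDomain D := by
  filter_upwards [Measure.support_mem_ae] with y hy
  by_cases hD : z + y ∈ D
  · exact Or.inr hD
  · exact Or.inl (Or.inr ⟨Set.mem_biUnion hz ⟨y, hy, rfl⟩, hD⟩)

lemma le_supDS {u : Rd d → ℝ} (hub : ∃ K : ℝ, ∀ x, |u x| ≤ K) {x : Rd d}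
    (hx : x ∈ A.extDomain D) : u x ≤ A.supDS D u := by
  obtain ⟨C, hC⟩ := hub
  have hbdd : BddAbove (u '' A.extDomain D) := ⟨C, by
    rintro _ ⟨y, -, rfl⟩
    exact (abs_le.1 (hC y)).2⟩
  exact le_csSup hbdd (Set.mem_image_of_mem u hx)

lemma LevyOp.closure_subset_extDomain : closure D ⊆ A.extDomain D := by
  rw [closure_eq_self_union_frontier]
  rintro x (hx | hx)
  · exact Or.inr hx
  · exact Or.inl (Or.inl hx)

/-- The indicator of a compact set away from `D` is the pointwise limit of smooth functions with
values in `[0, 1]` that vanish at distance less than some fixed `δ` from `D`. -/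
lemma exists_smooth_approx {K : Set (Rd d)} (hK : IsCompact K) (hKD : Disjoint K (closure D)) :
    ∃ δ > 0, ∃ f : ℕ → Rd d → ℝ, (∀ n, IsCb2 (f n)) ∧ (∀ n z, 0 ≤ f n z) ∧ (∀ n z, f n z ≤ 1) ∧
      (∀ n, ∀ z ∈ K, f n z = 1) ∧ (∀ z ∉ K, ∀ᶠ n in atTop, f n z = 0) ∧
      ∀ n, ∀ z ∈ D, ∀ y, f n y ≠ 0 → δ ≤ dist y z := by
  obtain ⟨δ, hδ, hdisj⟩ := hKD.exists_thickenings hK isClosed_closure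
  set r : ℕ → ℝ := fun n => min δ (1 / (n + 1 : ℝ)) with hr
  have hr0 : ∀ n, 0 < r n := fun n => lt_min hδ (by positivity)
  choose f hfc hfr hfs hf1 using fun n => exists_contMDiff_support_eq_eq_one_iff
    (n := (2 : ℕ∞)) (modelWithCornersSelf ℝ (Rd d)) (Metric.isOpen_thickening (δ := r n) (E := K))
    hK.isClosed (Metric.self_subset_thickening (hr0 n) K)
  refine ⟨δ, hδ, f, fun n => ?_, fun n z => (hfr n ⟨z, rfl⟩).1, fun n z => (hfr n ⟨z, rfl⟩).2,
    fun n z hz => (hf1 n z).1 hz, fun z hz => ?_, fun n z hz y hy => ?_⟩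
  · refine isCb2_of_hasCompactSupport (hfc n).contDiff ?_
    refine HasCompactSupport.of_support_subset_isCompact (hK.cthickening (r := r n)) ?_
    rw [hfs n]
    exact Metric.thickening_subset_cthickening _ _
  · obtain ⟨k, hk⟩ := exists_notMem_cthickening hK.isClosed.isOpen_compl
      (show z ∈ Kᶜ from hz)
    rw [compl_compl] at hk
    filter_upwards [eventually_ge_atTop k] with n hn
    by_contra hne
    have hmem : z ∈ Metric.thickening (r n) K := by rw [← hfs n]; exact hne
    refine hk (Metric.cthickening_mono ?_ _ (Metric.thickening_subset_cthickening _ _ hmem))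
    exact (min_le_right _ _).trans (by gcongr)
  · by_contra! hlt
    have h1 : y ∈ Metric.thickening δ K := by
      have : y ∈ Function.support (f n) := hy
      rw [hfs n] at this
      exact Metric.thickening_mono (min_le_left _ _) _ this
    have h2 : y ∈ Metric.thickening δ (closure D) :=
      Metric.mem_thickening_iff.2 ⟨z, subset_closure hz, hlt⟩
    exact Set.disjoint_left.1 hdisj h1 h2

/-- The process does not jump from `D` into a compact set outside the extended domain: by Dynkin's
formula for smooth functions converging to the indicator of that set, the probability of doing so
is the integral of jump intensities which vanish. -/
lemma IsMartingaleSolution.eval_innerExit_notMem_compact {x : Rd d} {μ : Measure (CadlagPath d)}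
    (h : IsMartingaleSolution A (Measure.dirac x) μ) (hD : IsOpen D) (hA2 : A.CondA2)
    (hx : x ∈ D) {K : Set (Rd d)} (hK : IsCompact K) (hKD : Disjoint K (A.extDomain D)) (t : ℝ≥0) :
    μ {ω | ω (capTime (innerExit D ω) t) ∈ K} = 0 := by
  have := h.prob
  obtain ⟨δ, hδ, f, hfC, hf0, hfle, hfK, hflim, hfD⟩ :=
    exists_smooth_approx hK (hKD.mono_right LevyOp.closure_subset_extDomain)
  obtain ⟨C, hC⟩ := hA2.bounded
  set B : ℝ≥0∞ := C / ENNReal.ofReal (min 1 (δ ^ 2)) with hB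
  have hBtop : B ≠ ⊤ := ENNReal.div_ne_top ENNReal.coe_ne_top (by
    have : 0 < min 1 (δ ^ 2) := by positivity
    exact (ENNReal.ofReal_pos.2 this).ne')
  have hvan : ∀ n, ∀ z ∈ D, f n z = 0 := fun n z hz => by
    by_contra hne
    have := hfD n z hz z hne
    rw [dist_self] at this
    exact absurd this hδ.not_ge
  have htail : ∀ z, MeasurableSet {y : Rd d | δ ≤ ‖y‖} ∧ A.N z {y | δ ≤ ‖y‖} ≤ B := fun z =>
    ⟨measurableSet_le measurable_const measurable_norm, LevyOp.measure_tail_le hC hδ z⟩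
  have hdom : ∀ n, ∀ z ∈ D, ∀ y, ‖f n (z + y)‖ ≤ {y : Rd d | δ ≤ ‖y‖}.indicator (fun _ => 1) y := by
    intro n z hz y
    by_cases hy : δ ≤ ‖y‖
    · rw [Set.indicator_of_mem (show y ∈ {y : Rd d | δ ≤ ‖y‖} from hy), Real.norm_eq_abs,
        abs_of_nonneg (hf0 n _)]
      exact hfle n _
    · have : f n (z + y) = 0 := by
        by_contra hne
        have := hfD n z hz _ hne
        rw [dist_eq_norm, add_sub_cancel_left] at this
        exact hy this
      rw [this, norm_zero]
      exact Set.indicator_nonneg (fun _ _ => zero_le_one) _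
  have hint : ∀ z, Integrable ({y : Rd d | δ ≤ ‖y‖}.indicator fun _ => (1 : ℝ)) (A.N z) := fun z =>
    (integrable_indicator_iff (htail z).1).2
      (integrableOn_const ((htail z).2.trans_lt hBtop.lt_top).ne)
  have hAbd : ∀ n, ∀ z ∈ D, ‖A.apply (f n) z‖ ≤ B.toReal := by
    intro n z hz
    rw [LevyOp.apply_eq_integral hD (hvan n) hz]
    refine (norm_integral_le_of_norm_le (hint z) (Eventually.of_forall (hdom n z hz))).trans ?_
    rw [integral_indicator_const _ (htail z).1, smul_eq_mul, mul_one]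
    exact ENNReal.toReal_mono hBtop (htail z).2
  have hAlim : ∀ z ∈ D, Tendsto (fun n => A.apply (f n) z) atTop (𝓝 0) := by
    intro z hz
    simp only [fun n => LevyOp.apply_eq_integral (A := A) hD (hvan n) hz]
    have := tendsto_integral_of_dominated_convergence (μ := A.N z) (F := fun n y => f n (z + y))
      (f := fun _ => (0 : ℝ)) _ (fun n =>
        ((hfC n).1.continuous.comp (continuous_const_add z)).aestronglyMeasurable) (hint z)
      (fun n => Eventually.of_forall (hdom n z hz)) (by
        filter_upwards [LevyOp.ae_add_mem_extDomain hz] with y hy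
        have hyK : z + y ∉ K := fun hyK => Set.disjoint_left.1 hKD hyK hy
        exact tendsto_const_nhds.congr' ((hflim _ hyK).mono fun n hn => hn.symm))
    simpa using this
  set S : CadlagPath d → ℝ≥0 := fun ω => capTime (innerExit D ω) t with hS
  have hSo : IsOptionalTime (filt d) S := isOptionalTime_innerExit t
  have hSt : ∀ ω, S ω ≤ t := fun ω => capTime_le _ _
  have hXm : Measurable fun ω : CadlagPath d => ω (S ω) := measurable_eval_at hSo.measurable
  have hSD : ∀ ω, ∀ r ∈ Set.uIoc (0 : ℝ) (S ω), r ≠ S ω → ω r.toNNReal ∈ D := by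
    intro ω r hr hne
    rw [Set.uIoc_of_le (NNReal.coe_nonneg _)] at hr
    refine mem_of_lt_innerExit (lt_of_lt_of_le ?_ (coe_capTime_le (innerExit D ω) t))
    rw [ENNReal.coe_lt_coe, Real.toNNReal_lt_iff_lt_coe hr.1.le]
    exact lt_of_le_of_ne hr.2 hne
  have hne : ∀ ω, ∀ᵐ r : ℝ, r ≠ S ω := fun ω => by simp [ae_iff]
  have hcomp : Tendsto (fun n => ∫ ω, compensator A (f n) (S ω) ω ∂μ) atTop (𝓝 0) := by
    have := tendsto_integral_of_dominated_convergence (μ := μ)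
      (F := fun n ω => compensator A (f n) (S ω) ω) (f := fun _ => (0 : ℝ)) (fun _ => B.toReal * t)
      (fun n => (h.integrable_compensator (hfC n) hSo hSt).1) (integrable_const _) (fun n => ?_) ?_
    · simpa using this
    · refine Eventually.of_forall fun ω => ?_
      have h1 : ‖compensator A (f n) (S ω) ω‖ ≤ B.toReal * |(S ω : ℝ) - 0| := by
        refine intervalIntegral.norm_integral_le_of_norm_le_const_ae ?_
        filter_upwards [hne ω] with r hr hr'
        exact hAbd n _ (hSD ω r hr' hr)
      refine h1.trans ?_
      rw [sub_zero, abs_of_nonneg (NNReal.coe_nonneg _)]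
      exact mul_le_mul_of_nonneg_left (NNReal.coe_le_coe.2 (hSt ω)) ENNReal.toReal_nonneg
    · filter_upwards [ae_all_iff.2 fun n => h.integrable (f n) (hfC n)] with ω hω
      have := intervalIntegral.tendsto_integral_filter_of_dominated_convergence (μ := volume)
        (F := fun n (r : ℝ) => A.apply (f n) (ω r.toNNReal)) (f := fun _ => (0 : ℝ))
        (a := 0) (b := S ω) (l := atTop) (fun _ => B.toReal)
        (Eventually.of_forall fun n => (intervalIntegrable_iff.1 (hω n (S ω))).1)
        (Eventually.of_forall fun n => by
          filter_upwards [hne ω] with r hr hr'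
          exact hAbd n _ (hSD ω r hr' hr)) (by simp)
        (by
          filter_upwards [hne ω] with r hr hr'
          exact hAlim _ (hSD ω r hr' hr))
      simpa [compensator] using this
  have hE : ∀ n, ∫ ω, f n (ω (S ω)) ∂μ = ∫ ω, compensator A (f n) (S ω) ω ∂μ := fun n => by
    have h0 : ∫ ω, f n (ω 0) ∂μ = 0 := by
      have : ∫ z, f n z ∂(μ.map fun ω => ω 0) = ∫ ω, f n (ω 0) ∂μ :=
        integral_map (measurable_eval 0).aemeasurable (hfC n).1.continuous.aestronglyMeasurable
      rw [← this, h.initial, integral_dirac]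
      exact hvan n x hx
    rw [h.dynkin (hfC n) hSo hSt, h0, zero_add]
  have hle : ∀ n, μ.real {ω | ω (S ω) ∈ K} ≤ ∫ ω, f n (ω (S ω)) ∂μ := fun n => by
    have hm : MeasurableSet {ω : CadlagPath d | ω (S ω) ∈ K} := hXm hK.measurableSet
    rw [← integral_indicator_one hm]
    refine integral_mono ((integrable_const (1 : ℝ)).indicator hm)
      ((hfC n).integrable_comp hXm) fun ω => ?_
    by_cases hω : ω (S ω) ∈ K
    · simp [Set.indicator, hω, hfK n _ hω]
    · simp [Set.indicator, hω, hf0]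
  have hfin : μ.real {ω | ω (S ω) ∈ K} ≤ 0 :=
    ge_of_tendsto' hcomp fun n => (hle n).trans_eq (hE n)
  exact (measureReal_eq_zero_iff).1 (le_antisymm hfin measureReal_nonneg)

/-- Up to the exit from `D` the process does not see values of `u` above its supremum over the
extended domain. -/
lemma IsMartingaleSolution.apply_eval_innerExit_le {x : Rd d} {μ : Measure (CadlagPath d)}
    (h : IsMartingaleSolution A (Measure.dirac x) μ) (hD : IsOpen D) (hA2 : A.CondA2)
    (hx : x ∈ D) {u : Rd d → ℝ} (hu : Measurable u) (hub : ∃ K : ℝ, ∀ x, |u x| ≤ K) (t : ℝ≥0) :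
    ∀ᵐ ω ∂μ, u (ω (capTime (innerExit D ω) t)) ≤ A.supDS D u := by
  have := h.prob
  obtain ⟨C, hC⟩ := hub
  have hXm : Measurable fun ω : CadlagPath d => ω (capTime (innerExit D ω) t) :=
    measurable_eval_at (isOptionalTime_innerExit t).measurable
  have hB : MeasurableSet {z | A.supDS D u < u z} := measurableSet_lt measurable_const hu
  have : IsProbabilityMeasure (μ.map fun ω => ω (capTime (innerExit D ω) t)) :=
    Measure.isProbabilityMeasure_map hXm.aemeasurable
  have hnull : (μ.map fun ω => ω (capTime (innerExit D ω) t)) {z | A.supDS D u < u z} = 0 := by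
    rw [hB.measure_eq_iSup_isCompact]
    simp only [ENNReal.iSup_eq_zero]
    intro K hKB hK
    rw [Measure.map_apply hXm hK.measurableSet]
    refine h.eval_innerExit_notMem_compact hD hA2 hx hK (Set.disjoint_left.2 fun z hzK hz => ?_) t
    exact (hKB hzK : A.supDS D u < u z).not_ge (le_supDS ⟨C, hC⟩ hz)
  rw [Measure.map_apply hXm hB] at hnull
  rw [ae_iff]
  simpa using hnull

end

section

/-! ### A minorisation condition for kernels dominating a fixed measure -/

section Minorization

variable {X : Type*} [MeasurableSpace X]

/-- If `E` has `m ⊗ m`-measure close to one, then many of its vertical sections have measure at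
least `3/4`. -/
lemma measure_section_pos {m : Measure X} [IsProbabilityMeasure m] {E : Set (X × X)}
    (hE : MeasurableSet E) (h : (m.prod m) Eᶜ < 1 / 4) :
    0 < m {x | m (Prod.mk x ⁻¹' Eᶜ) ≤ 1 / 4} := by
  by_contra! h0
  have hae : ∀ᵐ x ∂m, 1 / 4 ≤ m (Prod.mk x ⁻¹' Eᶜ) := by
    rw [ae_iff]
    refine measure_mono_null (fun x hx => ?_) (le_antisymm h0 zero_le)
    exact (not_le.1 hx).le
  have := lintegral_mono_ae hae
  rw [lintegral_const, measure_univ, mul_one, ← Measure.prod_apply hE.compl] at this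
  exact absurd h this.not_gt

/-- Kernel densities which are almost everywhere positive are bounded below after one composition
on a product of sets of positive measure. -/
lemma exists_lower_bound_comp {m : Measure X} [IsProbabilityMeasure m] {r : X → X → ℝ≥0∞}
    (hr : Measurable (Function.uncurry r)) (hpos : ∀ᵐ x ∂m, ∀ᵐ y ∂m, 0 < r x y) :
    ∃ (c : ℝ≥0∞) (A B : Set X), 0 < c ∧ c ≠ ⊤ ∧ MeasurableSet A ∧ MeasurableSet B ∧ 0 < m A ∧
      0 < m B ∧ ∀ x ∈ A, ∀ z ∈ B, c ≤ ∫⁻ y, r x y * r y z ∂m := by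
  -- Superlevel sets of the density, which exhaust the product space up to a null set.
  set E : ℕ → Set (X × X) := fun n => {p | ((n : ℝ≥0∞) + 1)⁻¹ ≤ Function.uncurry r p} with hE
  have hEm : ∀ n, MeasurableSet (E n) := fun n => measurableSet_le measurable_const hr
  have hanti : Antitone fun n => (E n)ᶜ := by
    refine fun k n hkn => Set.compl_subset_compl.2 fun p hp => ?_
    have hp : ((k : ℝ≥0∞) + 1)⁻¹ ≤ Function.uncurry r p := hp
    refine le_trans ?_ hp
    gcongr
  have hnull : (m.prod m) (⋂ n, (E n)ᶜ) = 0 := by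
    rw [Measure.measure_prod_null (MeasurableSet.iInter fun n => (hEm n).compl)]
    filter_upwards [hpos] with x hx
    refine measure_mono_null (fun y hy => ?_) (ae_iff.1 hx)
    simp only [Set.mem_preimage, Set.mem_iInter, Set.mem_compl_iff] at hy
    intro (hxy : 0 < r x y)
    obtain ⟨n, hn⟩ := ENNReal.exists_inv_nat_lt hxy.ne'
    refine hy n ((ENNReal.inv_le_inv.2 ?_).trans hn.le)
    exact le_self_add
  have hlim := tendsto_measure_iInter_atTop (μ := m.prod m)
    (fun n => (hEm n).compl.nullMeasurableSet) hanti ⟨0, measure_ne_top _ _⟩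
  rw [hnull] at hlim
  obtain ⟨n, hn⟩ := (hlim.eventually_lt_const (by simp : (0 : ℝ≥0∞) < 1 / 4)).exists
  set ε : ℝ≥0∞ := ((n : ℝ≥0∞) + 1)⁻¹ with hε
  have hε0 : ε ≠ 0 := by simp [hε]
  have hεt : ε ≠ ⊤ := by simp [hε]
  have hswap : (m.prod m) (Prod.swap ⁻¹' E n)ᶜ < 1 / 4 := by
    rw [← Set.preimage_compl, ← Measure.map_apply measurable_swap (hEm n).compl, Measure.prod_swap]
    exact hn
  refine ⟨ε * ε * 2⁻¹, {x | m (Prod.mk x ⁻¹' (E n)ᶜ) ≤ 1 / 4},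
    {z | m (Prod.mk z ⁻¹' (Prod.swap ⁻¹' E n)ᶜ) ≤ 1 / 4}, ?_, ?_,
    measurableSet_le (measurable_measure_prodMk_left (hEm n).compl) measurable_const,
    measurableSet_le (measurable_measure_prodMk_left (measurable_swap (hEm n)).compl)
      measurable_const,
    measure_section_pos (hEm n) hn, measure_section_pos (measurable_swap (hEm n)) hswap, ?_⟩
  · exact pos_iff_ne_zero.2 (mul_ne_zero (mul_ne_zero hε0 hε0) (by simp))
  · exact ENNReal.mul_ne_top (ENNReal.mul_ne_top hεt hεt) (by simp)
  intro x hx z hz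
  -- The exceptional sets of the two sections have total measure at most `1/2`.
  set G : Set X := {y | (x, y) ∈ E n ∧ (y, z) ∈ E n} with hG
  have hGm : MeasurableSet G :=
    (measurable_prodMk_left (hEm n)).inter (measurable_prodMk_right (hEm n))
  have hGc : m Gᶜ ≤ 2⁻¹ := by
    have hsub : Gᶜ ⊆ (Prod.mk x ⁻¹' (E n)ᶜ) ∪ (Prod.mk z ⁻¹' (Prod.swap ⁻¹' E n)ᶜ) := by
      intro y hy
      by_contra hn
      simp only [Set.mem_union, Set.mem_preimage, Set.mem_compl_iff, not_or, not_not,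
        Prod.swap_prod_mk] at hn
      exact hy hn
    refine ((measure_mono hsub).trans (measure_union_le _ _)).trans ((add_le_add hx hz).trans ?_)
    have : (1 / 4 : ℝ≥0∞) = 2⁻¹ / 2 := by
      rw [div_eq_mul_inv, div_eq_mul_inv, one_mul, ← ENNReal.mul_inv (by simp) (by simp)]
      norm_num
    rw [this, ENNReal.add_halves]
  have hG2 : 2⁻¹ ≤ m G := by
    by_contra! hlt
    have := measure_add_measure_compl (μ := m) hGm
    rw [measure_univ] at this
    have h1 : m G + m Gᶜ < 2⁻¹ + 2⁻¹ := ENNReal.add_lt_add_of_lt_of_le (measure_ne_top _ _) hlt hGc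
    rw [this, ENNReal.inv_two_add_inv_two] at h1
    exact lt_irrefl _ h1
  calc ε * ε * 2⁻¹ ≤ ε * ε * m G := by gcongr
    _ = ∫⁻ y in G, ε * ε ∂m := by simp
    _ ≤ ∫⁻ y in G, r x y * r y z ∂m :=
        setLIntegral_mono_ae' hGm (Eventually.of_forall fun y hy => mul_le_mul' hy.1 hy.2)
    _ ≤ ∫⁻ y, r x y * r y z ∂m := setLIntegral_le_lintegral _ _

/-- Minorisation of the superharmonic functions of a kernel `R` all of whose values dominate a
probability measure `m`. The fourth power of `R` is bounded below by a rank-one kernel `ψ ⊗ ν`: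
two steps produce a density bounded below on a product `A × B` of sets of positive measure, one
more step before them reaches `A` from every point, and one more step after them spreads the mass
from `B` to a measure dominating `m`. -/
theorem exists_minorization [MeasurableSpace.CountableOrCountablyGenerated X X] (R : Kernel X X) [IsFiniteKernel R] {D : Set X} (hD : MeasurableSet D)
    (m : Measure X) [IsProbabilityMeasure m] (hmD : ∀ᵐ x ∂m, x ∈ D) (hR : ∀ x ∈ D, m ≪ R x) :
    ∃ (ψ : X → ℝ≥0∞) (ν : Measure X), Measurable ψ ∧ (∀ x, ψ x ≠ ⊤) ∧ (∀ x ∈ D, 0 < ψ x) ∧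
      m ≪ ν ∧ ∀ h w : X → ℝ≥0∞, Measurable h → Measurable w →
        (∀ x ∈ D, ∫⁻ y, h y ∂(R x) ≤ w x) → (∀ x ∈ D, ∫⁻ y, w y ∂(R x) ≤ w x) →
        ∀ x ∈ D, ψ x * ∫⁻ y, h y ∂ν ≤ w x := by
  set r : X → X → ℝ≥0∞ := fun x y => R.rnDeriv (Kernel.const X m) x y with hr
  have hrm : Measurable (Function.uncurry r) := Kernel.measurable_rnDeriv R (Kernel.const X m)
  have hrle : ∀ x (f : X → ℝ≥0∞), Measurable f → ∫⁻ y, r x y * f y ∂m ≤ ∫⁻ y, f y ∂(R x) := by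
    intro x f hf
    have h1 := Kernel.withDensity_rnDeriv_le R (Kernel.const X m) x
    rw [Kernel.withDensity_apply _ (Kernel.measurable_rnDeriv _ _), Kernel.const_apply] at h1
    refine le_trans (le_of_eq ?_) (lintegral_mono' h1 le_rfl)
    rw [lintegral_withDensity_eq_lintegral_mul _ (Kernel.measurable_rnDeriv_right _ _ _) hf]
    rfl
  have hpos : ∀ᵐ x ∂m, ∀ᵐ y ∂m, 0 < r x y := by
    filter_upwards [hmD] with x hx
    have h1 := Kernel.rnDeriv_eq_rnDeriv_measure (κ := R) (η := Kernel.const X m) (a := x)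
    rw [Kernel.const_apply] at h1
    filter_upwards [h1, Measure.rnDeriv_pos' (hR x hx)] with y hy hy'
    exact hy'.trans_eq hy.symm
  obtain ⟨c, A, B, hc, hct, hA, hB, hmA, hmB, hcAB⟩ := exists_lower_bound_comp hrm hpos
  refine ⟨fun x => R x (A ∩ D) * c, (m.restrict B).bind R,
    (R.measurable_coe (hA.inter hD)).mul_const c,
    fun x => ENNReal.mul_ne_top (measure_ne_top _ _) hct, fun x hx => ?_, ?_, ?_⟩
  · refine ENNReal.mul_pos (fun h0 => hmA.ne' ?_) hc.ne'
    have := hR x hx h0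
    rwa [measure_inter_conull' ?_] at this
    exact measure_mono_null (fun y hy => hy.2) hmD
  · refine Measure.AbsolutelyContinuous.mk fun S hS h0 => ?_
    rw [Measure.bind_apply hS R.measurable.aemeasurable,
      lintegral_eq_zero_iff (R.measurable_coe hS)] at h0
    by_contra hne
    refine hmB.ne' ?_
    have h1 : ∀ᵐ x ∂m.restrict B, False := by
      filter_upwards [h0, ae_restrict_of_ae hmD] with x hx hxD
      exact hne (hR x hxD hx)
    rw [← Measure.restrict_eq_zero, ← ae_eq_bot]
    simpa using h1
  · intro h w hh hw hRh hRw x hx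
    rw [Measure.lintegral_bind R.measurable.aemeasurable hh.aemeasurable]
    have hB' : ∫⁻ z in B, ∫⁻ y, h y ∂(R z) ∂m ≤ ∫⁻ z in B, w z ∂m := by
      refine lintegral_mono_ae (ae_restrict_of_ae ?_)
      filter_upwards [hmD] with z hz using hRh z hz
    have hA' : ∀ a ∈ A ∩ D, c * ∫⁻ z in B, w z ∂m ≤ w a := by
      intro a ha
      calc c * ∫⁻ z in B, w z ∂m = ∫⁻ z in B, c * w z ∂m := (lintegral_const_mul _ hw).symm
        _ ≤ ∫⁻ z in B, (∫⁻ y, r a y * r y z ∂m) * w z ∂m :=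
            setLIntegral_mono_ae' hB (Eventually.of_forall fun z hz => by
              gcongr; exact hcAB a ha.1 z hz)
        _ ≤ ∫⁻ z, (∫⁻ y, r a y * r y z ∂m) * w z ∂m := setLIntegral_le_lintegral _ _
        _ = ∫⁻ z, ∫⁻ y, r a y * (r y z * w z) ∂m ∂m := by
            refine lintegral_congr fun z => ?_
            rw [← lintegral_mul_const]
            · simp only [mul_assoc]
            · exact (hrm.comp measurable_prodMk_left).mul (hrm.comp measurable_prodMk_right)
        _ = ∫⁻ y, ∫⁻ z, r a y * (r y z * w z) ∂m ∂m := by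
            refine lintegral_lintegral_swap (Measurable.aemeasurable ?_)
            exact (hrm.comp (measurable_const.prodMk measurable_snd)).mul
              ((hrm.comp (measurable_snd.prodMk measurable_fst)).mul (hw.comp measurable_fst))
        _ = ∫⁻ y, r a y * ∫⁻ z, r y z * w z ∂m ∂m := by
            refine lintegral_congr fun y => ?_
            rw [lintegral_const_mul]
            exact (hrm.comp measurable_prodMk_left).mul hw
        _ ≤ ∫⁻ y, r a y * w y ∂m := by
            refine lintegral_mono_ae ?_
            filter_upwards [hmD] with y hy
            gcongr
            exact (hrle y w hw).trans (hRw y hy)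
        _ ≤ w a := (hrle a w hw).trans (hRw a ha.2)
    calc R x (A ∩ D) * c * ∫⁻ z in B, ∫⁻ y, h y ∂(R z) ∂m
        ≤ R x (A ∩ D) * (c * ∫⁻ z in B, w z ∂m) := by rw [mul_assoc]; gcongr
      _ = ∫⁻ a in A ∩ D, c * ∫⁻ z in B, w z ∂m ∂(R x) := by
          rw [setLIntegral_const, mul_comm]
      _ ≤ ∫⁻ a in A ∩ D, w a ∂(R x) :=
          setLIntegral_mono_ae' (hA.inter hD) (Eventually.of_forall hA')
      _ ≤ ∫⁻ a, w a ∂(R x) := setLIntegral_le_lintegral _ _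
      _ ≤ w x := hRw x hx

end Minorization

end

section

open CadlagPath

/-! ### Occupation integrals and the killed resolvent kernel -/

variable {d : ℕ} {D : Set (Rd d)}

/-- The integral `∫_0^s f(X_r) dr` of a function with values in `[0, ∞]`. -/
noncomputable def occ (f : Rd d → ℝ≥0∞) (ω : CadlagPath d) (s : ℝ≥0∞) : ℝ≥0∞ :=
  ∫⁻ r in {r : ℝ | 0 ≤ r ∧ ENNReal.ofReal r < s}, f (ω r.toNNReal)

lemma measurableSet_timesBefore (s : ℝ≥0∞) :
    MeasurableSet {r : ℝ | 0 ≤ r ∧ ENNReal.ofReal r < s} :=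
  (measurableSet_le measurable_const measurable_id).inter
    (measurableSet_lt ENNReal.measurable_ofReal measurable_const)

lemma measurable_lintegral_timesBefore {F : CadlagPath d × ℝ → ℝ≥0∞} (hF : Measurable F) :
    Measurable fun p : CadlagPath d × ℝ≥0∞ =>
      ∫⁻ r in {r : ℝ | 0 ≤ r ∧ ENNReal.ofReal r < p.2}, F (p.1, r) := by
  have heq : ∀ p : CadlagPath d × ℝ≥0∞,
      ∫⁻ r in {r : ℝ | 0 ≤ r ∧ ENNReal.ofReal r < p.2}, F (p.1, r) =
        ∫⁻ r, {q : (CadlagPath d × ℝ≥0∞) × ℝ | 0 ≤ q.2 ∧ ENNReal.ofReal q.2 < q.1.2}.indicator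
          (fun q => F (q.1.1, q.2)) (p, r) := fun p => by
    rw [← lintegral_indicator (measurableSet_timesBefore p.2)]
    rfl
  simp only [heq]
  refine Measurable.lintegral_prod_right' (f := Set.indicator _ _) (Measurable.indicator ?_ ?_)
  · exact hF.comp ((measurable_fst.comp measurable_fst).prodMk measurable_snd)
  · exact (measurableSet_le measurable_const measurable_snd).inter
      (measurableSet_lt (ENNReal.measurable_ofReal.comp measurable_snd)
        (measurable_snd.comp measurable_fst))

lemma measurable_comp_eval {α : Type*} [MeasurableSpace α] {f : Rd d → ℝ≥0∞} (hf : Measurable f)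
    {a : α → CadlagPath d} {b : α → ℝ} (ha : Measurable a) (hb : Measurable b) :
    Measurable fun p => f (a p (b p).toNNReal) :=
  hf.comp (measurable_eval_comp ha hb.real_toNNReal)

lemma measurable_occ {f : Rd d → ℝ≥0∞} (hf : Measurable f) :
    Measurable fun p : CadlagPath d × ℝ≥0∞ => occ f p.1 p.2 :=
  measurable_lintegral_timesBefore (measurable_comp_eval hf measurable_fst measurable_snd)

lemma eval_mem_of_timesBefore {ω : CadlagPath d} {s : ℝ≥0∞} (hs : s ≤ innerExit D ω) {r : ℝ}
    (hr : r ∈ {r : ℝ | 0 ≤ r ∧ ENNReal.ofReal r < s}) : ω r.toNNReal ∈ D :=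
  mem_of_lt_innerExit (lt_of_lt_of_le hr.2 hs)

lemma occ_mono_on {f f' : Rd d → ℝ≥0∞} (h : ∀ z ∈ D, f z ≤ f' z) {ω : CadlagPath d} {s : ℝ≥0∞}
    (hs : s ≤ innerExit D ω) : occ f ω s ≤ occ f' ω s :=
  setLIntegral_mono' (measurableSet_timesBefore s) fun _ hr => h _ (eval_mem_of_timesBefore hs hr)

lemma occ_congr_on {f f' : Rd d → ℝ≥0∞} (h : ∀ z ∈ D, f z = f' z) {ω : CadlagPath d} {s : ℝ≥0∞}
    (hs : s ≤ innerExit D ω) : occ f ω s = occ f' ω s :=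
  le_antisymm (occ_mono_on (fun z hz => (h z hz).le) hs) (occ_mono_on (fun z hz => (h z hz).ge) hs)

lemma volume_timesBefore_le (s : ℝ≥0) :
    volume {r : ℝ | 0 ≤ r ∧ ENNReal.ofReal r < s} ≤ s := by
  refine (measure_mono (t := Set.Ico 0 (s : ℝ)) fun r hr => ⟨hr.1, ?_⟩).trans (by simp)
  have h2 := hr.2
  rwa [ENNReal.ofReal, ENNReal.coe_lt_coe, Real.toNNReal_lt_iff_lt_coe hr.1] at h2

lemma occ_le_of_le {f : Rd d → ℝ≥0∞} {C : ℝ≥0∞} (h : ∀ z ∈ D, f z ≤ C) {ω : CadlagPath d}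
    {s : ℝ≥0} (hs : (s : ℝ≥0∞) ≤ innerExit D ω) : occ f ω s ≤ C * s := by
  refine (occ_mono_on h hs).trans ?_
  rw [occ, setLIntegral_const]
  gcongr
  exact volume_timesBefore_le s

/-- The measure with density `e^{-α t}` on `[0, ∞)`. -/
noncomputable def expWeight (α : ℝ) : Measure ℝ :=
  (volume.restrict (Set.Ici 0)).withDensity fun t => ENNReal.ofReal (Real.exp (-α * t))

lemma measurable_ofReal_exp (α : ℝ) : Measurable fun t : ℝ => ENNReal.ofReal (Real.exp (-α * t)) := by
  fun_prop

lemma isFiniteMeasure_expWeight {α : ℝ} (hα : 0 < α) : IsFiniteMeasure (expWeight α) := by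
  refine isFiniteMeasure_withDensity_ofReal ?_
  exact ((integrableOn_Ici_iff_integrableOn_Ioi (by simp)).2 (exp_neg_integrableOn_Ioi 0 hα)).2

lemma lintegral_exp_neg : ∫⁻ t in Set.Ici (0 : ℝ), ENNReal.ofReal (Real.exp (-1 * t)) = 1 := by
  rw [← ofReal_integral_eq_lintegral_ofReal
    ((integrableOn_Ici_iff_integrableOn_Ioi (by simp)).2 (exp_neg_integrableOn_Ioi 0 one_pos))
    (Eventually.of_forall fun t => (Real.exp_pos _).le), integral_Ici_eq_integral_Ioi]
  simp [integral_exp_Iic_zero]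

instance (α : ℝ) : SFinite (expWeight α) := by unfold expWeight; infer_instance

/-- The kernel `f ↦ E_x ∫_0^T e^{-α t} f(X_t) dt`, where `T` is the inner exit time from `D`. -/
noncomputable def killedKernel (P : Kernel (Rd d) (CadlagPath d)) (D : Set (Rd d)) (α : ℝ) :
    Kernel (Rd d) (Rd d) :=
  ((P ×ₖ Kernel.const (Rd d) (expWeight α)).restrict
    (s := {p : CadlagPath d × ℝ | ENNReal.ofReal p.2 < innerExit D p.1})
    (measurableSet_lt (ENNReal.measurable_ofReal.comp measurable_snd)
      (measurable_innerExit.comp measurable_fst))).map fun p => p.1 p.2.toNNReal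

variable {P : Kernel (Rd d) (CadlagPath d)}

lemma isFiniteKernel_killedKernel [IsMarkovKernel P] {α : ℝ} (hα : 0 < α) :
    IsFiniteKernel (killedKernel P D α) := by
  have := isFiniteMeasure_expWeight hα
  unfold killedKernel
  infer_instance

lemma lintegral_killedKernel [IsMarkovKernel P] (α : ℝ) {f : Rd d → ℝ≥0∞} (hf : Measurable f)
    (x : Rd d) : ∫⁻ y, f y ∂(killedKernel P D α x) =
      ∫⁻ ω, (∫⁻ t in {t : ℝ | 0 ≤ t ∧ ENNReal.ofReal t < innerExit D ω},
        ENNReal.ofReal (Real.exp (-α * t)) * f (ω t.toNNReal)) ∂(P x) := by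
  have hs : MeasurableSet {p : CadlagPath d × ℝ | ENNReal.ofReal p.2 < innerExit D p.1} :=
    measurableSet_lt (ENNReal.measurable_ofReal.comp measurable_snd)
      (measurable_innerExit.comp measurable_fst)
  have hfm : Measurable fun p : CadlagPath d × ℝ => f (p.1 p.2.toNNReal) :=
    measurable_comp_eval hf measurable_fst measurable_snd
  rw [killedKernel, Kernel.lintegral_map _
    (measurable_eval_comp measurable_fst measurable_snd.real_toNNReal) _ hf,
    Kernel.lintegral_restrict, Kernel.prod_apply, Kernel.const_apply,
    ← lintegral_indicator hs, lintegral_prod _ (hfm.indicator hs).aemeasurable]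
  refine lintegral_congr fun ω => ?_
  have hsec : Measurable fun t : ℝ => {p : CadlagPath d × ℝ | ENNReal.ofReal p.2 <
      innerExit D p.1}.indicator (fun p => f (p.1 p.2.toNNReal)) (ω, t) :=
    (hfm.indicator hs).comp measurable_prodMk_left
  rw [expWeight, lintegral_withDensity_eq_lintegral_mul _ (measurable_ofReal_exp α) hsec,
    ← lintegral_indicator (measurableSet_timesBefore _), ← lintegral_indicator measurableSet_Ici]
  refine lintegral_congr fun t => ?_
  by_cases h0 : 0 ≤ t <;> by_cases h1 : ENNReal.ofReal t < innerExit D ω <;>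
    simp [Set.indicator, h0, h1]

lemma lintegral_killedKernel_swap [IsMarkovKernel P] (α : ℝ) {f : Rd d → ℝ≥0∞} (hf : Measurable f)
    (x : Rd d) : ∫⁻ y, f y ∂(killedKernel P D α x) =
      ∫⁻ t in Set.Ici (0 : ℝ), ENNReal.ofReal (Real.exp (-α * t)) *
        ∫⁻ ω, {ω | ENNReal.ofReal t < innerExit D ω}.indicator (fun ω => f (ω t.toNNReal)) ω
          ∂(P x) := by
  have hs : MeasurableSet {p : CadlagPath d × ℝ | ENNReal.ofReal p.2 < innerExit D p.1} :=
    measurableSet_lt (ENNReal.measurable_ofReal.comp measurable_snd)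
      (measurable_innerExit.comp measurable_fst)
  have hfm : Measurable fun p : CadlagPath d × ℝ => f (p.1 p.2.toNNReal) :=
    measurable_comp_eval hf measurable_fst measurable_snd
  have hind := hfm.indicator hs
  calc ∫⁻ y, f y ∂(killedKernel P D α x)
      = ∫⁻ ω, (∫⁻ t in Set.Ici (0 : ℝ), ENNReal.ofReal (Real.exp (-α * t)) *
          {p : CadlagPath d × ℝ | ENNReal.ofReal p.2 < innerExit D p.1}.indicator
            (fun p => f (p.1 p.2.toNNReal)) (ω, t)) ∂(P x) := by
        rw [lintegral_killedKernel α hf]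
        refine lintegral_congr fun ω => ?_
        rw [← lintegral_indicator (measurableSet_timesBefore _),
          ← lintegral_indicator measurableSet_Ici]
        refine lintegral_congr fun t => ?_
        by_cases h0 : 0 ≤ t <;> by_cases h1 : ENNReal.ofReal t < innerExit D ω <;>
          simp [Set.indicator, h0, h1]
    _ = ∫⁻ t in Set.Ici (0 : ℝ), ∫⁻ ω, ENNReal.ofReal (Real.exp (-α * t)) *
          {p : CadlagPath d × ℝ | ENNReal.ofReal p.2 < innerExit D p.1}.indicator
            (fun p => f (p.1 p.2.toNNReal)) (ω, t) ∂(P x) := by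
        refine lintegral_lintegral_swap (Measurable.aemeasurable ?_)
        exact ((measurable_ofReal_exp α).comp measurable_snd).mul hind
    _ = _ := by
        refine lintegral_congr fun t => ?_
        exact lintegral_const_mul _ (hind.comp measurable_prodMk_right)

/-- A tail of the exponential weight is at least a constant multiple of its density. -/
lemma le_lintegral_exp_Ioi {α r : ℝ} (hα : 0 ≤ α) (hr : 0 ≤ r) :
    ENNReal.ofReal (Real.exp (-α)) * ENNReal.ofReal (Real.exp (-α * r)) ≤
      ∫⁻ t in Set.Ici (0 : ℝ), (Set.Ioi r).indicator
        (fun t => ENNReal.ofReal (Real.exp (-α * t))) t := by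
  rw [lintegral_indicator measurableSet_Ioi, Measure.restrict_restrict measurableSet_Ioi,
    ← ENNReal.ofReal_mul (Real.exp_pos _).le, ← Real.exp_add]
  -- The contribution of a unit interval is already enough.
  have hsub : Set.Ioc r (r + 1) ⊆ Set.Ioi r ∩ Set.Ici 0 := fun t ht => ⟨ht.1, hr.trans ht.1.le⟩
  calc ENNReal.ofReal (Real.exp (-α + -α * r))
      = ∫⁻ _ in Set.Ioc r (r + 1), ENNReal.ofReal (Real.exp (-α + -α * r)) := by simp
    _ ≤ ∫⁻ t in Set.Ioc r (r + 1), ENNReal.ofReal (Real.exp (-α * t)) := by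
        refine setLIntegral_mono' measurableSet_Ioc fun t ht => ?_
        gcongr
        nlinarith [ht.2]
    _ ≤ _ := lintegral_mono_set hsub

/-- The killed resolvent is controlled by an exponential average of the occupation integrals up to
deterministic times. -/
lemma killedKernel_le_lintegral_occ [IsMarkovKernel P] {α : ℝ} (hα : 0 ≤ α) {f : Rd d → ℝ≥0∞}
    (hf : Measurable f) (x : Rd d) :
    ENNReal.ofReal (Real.exp (-α)) * ∫⁻ y, f y ∂(killedKernel P D α x) ≤
      ∫⁻ t in Set.Ici (0 : ℝ), ENNReal.ofReal (Real.exp (-α * t)) *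
        ∫⁻ ω, occ f ω (capTime (innerExit D ω) t.toNNReal) ∂(P x) := by
  have hcap : Measurable fun p : CadlagPath d × ℝ =>
      ((capTime (innerExit D p.1) p.2.toNNReal : ℝ≥0) : ℝ≥0∞) := by
    simp only [coe_capTime]
    exact (measurable_innerExit.comp measurable_fst).min
      (measurable_snd.real_toNNReal.coe_nnreal_ennreal)
  have hocc : Measurable fun p : CadlagPath d × ℝ =>
      occ f p.1 (capTime (innerExit D p.1) p.2.toNNReal) :=
    (measurable_occ hf).comp (measurable_fst.prodMk hcap)
  have hswap : ∫⁻ t in Set.Ici (0 : ℝ), ENNReal.ofReal (Real.exp (-α * t)) *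
        ∫⁻ ω, occ f ω (capTime (innerExit D ω) t.toNNReal) ∂(P x) =
      ∫⁻ ω, (∫⁻ t in Set.Ici (0 : ℝ), ENNReal.ofReal (Real.exp (-α * t)) *
        occ f ω (capTime (innerExit D ω) t.toNNReal)) ∂(P x) := by
    rw [← lintegral_lintegral_swap]
    · refine lintegral_congr fun t => ?_
      exact (lintegral_const_mul _ (hocc.comp measurable_prodMk_right)).symm
    · exact (((measurable_ofReal_exp α).comp measurable_fst).mul
        (hocc.comp measurable_swap)).aemeasurable
  rw [hswap, lintegral_killedKernel α hf, ← lintegral_const_mul' _ _ ENNReal.ofReal_ne_top]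
  refine lintegral_mono fun ω => ?_
  set s := {r : ℝ | 0 ≤ r ∧ ENNReal.ofReal r < innerExit D ω} with hs
  have hsm : MeasurableSet s := measurableSet_timesBefore _
  have hfω : Measurable fun r : ℝ => f (ω r.toNNReal) :=
    measurable_comp_eval hf measurable_const measurable_id
  have hocc_eq : ∀ t : ℝ, 0 ≤ t → occ f ω (capTime (innerExit D ω) t.toNNReal) =
      ∫⁻ r in s, (Set.Iio t).indicator (fun r => f (ω r.toNNReal)) r := by
    intro t ht
    rw [occ, lintegral_indicator measurableSet_Iio, Measure.restrict_restrict measurableSet_Iio]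
    congr 2
    ext r
    simp only [hs, coe_capTime, lt_min_iff, Set.mem_inter_iff, Set.mem_Iio, Set.mem_ofPred_eq]
    constructor
    · rintro ⟨h1, h2, h3⟩
      refine ⟨?_, h1, h2⟩
      rwa [ENNReal.ofReal, ENNReal.coe_lt_coe, Real.toNNReal_lt_toNNReal_iff_of_nonneg h1] at h3
    · rintro ⟨h1, h2, h3⟩
      refine ⟨h2, h3, ?_⟩
      rwa [ENNReal.ofReal, ENNReal.coe_lt_coe, Real.toNNReal_lt_toNNReal_iff_of_nonneg h2]
  have hjoint : Measurable fun p : ℝ × ℝ => ENNReal.ofReal (Real.exp (-α * p.1)) *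
      (Set.Iio p.1).indicator (fun r => f (ω r.toNNReal)) p.2 := by
    refine ((measurable_ofReal_exp α).comp measurable_fst).mul ?_
    exact (hfω.comp measurable_snd).indicator (measurableSet_lt measurable_snd measurable_fst)
  calc ENNReal.ofReal (Real.exp (-α)) *
        ∫⁻ r in s, ENNReal.ofReal (Real.exp (-α * r)) * f (ω r.toNNReal)
      = ∫⁻ r in s, ENNReal.ofReal (Real.exp (-α)) * ENNReal.ofReal (Real.exp (-α * r)) *
          f (ω r.toNNReal) := by
        rw [← lintegral_const_mul' _ _ ENNReal.ofReal_ne_top]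
        simp only [mul_assoc]
    _ ≤ ∫⁻ r in s, ∫⁻ t in Set.Ici (0 : ℝ), ENNReal.ofReal (Real.exp (-α * t)) *
          (Set.Iio t).indicator (fun r => f (ω r.toNNReal)) r := by
        refine setLIntegral_mono' hsm fun r hr => ?_
        refine (mul_le_mul_left (le_lintegral_exp_Ioi hα hr.1) _).trans ?_
        rw [← lintegral_mul_const _ ((measurable_ofReal_exp α).indicator measurableSet_Ioi)]
        refine lintegral_mono fun t => ?_
        by_cases h : r < t <;> simp [h]
    _ = ∫⁻ t in Set.Ici (0 : ℝ), ∫⁻ r in s, ENNReal.ofReal (Real.exp (-α * t)) *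
          (Set.Iio t).indicator (fun r => f (ω r.toNNReal)) r :=
        (lintegral_lintegral_swap hjoint.aemeasurable).symm
    _ = ∫⁻ t in Set.Ici (0 : ℝ), ENNReal.ofReal (Real.exp (-α * t)) *
          occ f ω (capTime (innerExit D ω) t.toNNReal) := by
        refine setLIntegral_congr_fun measurableSet_Ici fun t ht => ?_
        rw [hocc_eq t ht, lintegral_const_mul _ (hfω.indicator measurableSet_Iio)]

end

section

open CadlagPath

/-! ### Discounting and the gauge function -/

variable {d : ℕ} {D : Set (Rd d)}

/-- The extension by zero from `D` of a real function, truncated below at zero, as a function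
with values in `[0, ∞]`. -/
noncomputable def zeroExt (D : Set (Rd d)) (f : Rd d → ℝ) : Rd d → ℝ≥0∞ :=
  D.indicator fun x => ENNReal.ofReal (f x)

lemma zeroExt_of_mem {f : Rd d → ℝ} {x : Rd d} (hx : x ∈ D) :
    zeroExt D f x = ENNReal.ofReal (f x) := Set.indicator_of_mem hx _

lemma measurable_zeroExt (hD : MeasurableSet D) {f : Rd d → ℝ} (hf : BorelOn D f) :
    Measurable (zeroExt D f) := by
  refine measurable_of_restrict_of_restrict_compl hD ?_ ?_
  · have : D.domRestrict (zeroExt D f) = fun x : D => ENNReal.ofReal (f x) := by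
      ext x; exact zeroExt_of_mem x.2
    rw [this]
    exact ENNReal.measurable_ofReal.comp hf
  · have : Dᶜ.domRestrict (zeroExt D f) = fun _ => 0 := by
      ext x; exact Set.indicator_of_notMem x.2 fun x => ENNReal.ofReal (f x)
    rw [this]
    exact measurable_const

/-- `e^{-a}` for `a ∈ [0, ∞]`. -/
noncomputable def expNeg (a : ℝ≥0∞) : ℝ := if a = ⊤ then 0 else Real.exp (-a.toReal)

lemma measurable_expNeg : Measurable expNeg :=
  Measurable.ite (measurableSet_singleton _) measurable_const
    (Real.measurable_exp.comp ENNReal.measurable_toReal.neg)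

lemma expNeg_nonneg (a : ℝ≥0∞) : 0 ≤ expNeg a := by
  unfold expNeg; split_ifs <;> positivity

lemma expNeg_le_one (a : ℝ≥0∞) : expNeg a ≤ 1 := by
  unfold expNeg
  split_ifs
  · exact zero_le_one
  · exact Real.exp_le_one_iff.2 (by simp)

lemma expNeg_of_ne_top {a : ℝ≥0∞} (ha : a ≠ ⊤) : expNeg a = Real.exp (-a.toReal) := if_neg ha

lemma expNeg_pos {a : ℝ≥0∞} (ha : a ≠ ⊤) : 0 < expNeg a := by
  rw [expNeg_of_ne_top ha]; positivity

lemma le_expNeg {a : ℝ≥0∞} {b : ℝ} (hb : 0 ≤ b) (ha : a ≤ ENNReal.ofReal b) :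
    Real.exp (-b) ≤ expNeg a := by
  rw [expNeg_of_ne_top (ne_top_of_le_ne_top ENNReal.ofReal_ne_top ha)]
  exact Real.exp_le_exp.2 (neg_le_neg (ENNReal.toReal_le_of_le_ofReal hb ha))

/-- `1 - e^{-a} ≥ a e^{-a}`. -/
lemma mul_expNeg_le {a : ℝ≥0∞} (ha : a ≠ ⊤) : a.toReal * expNeg a ≤ 1 - expNeg a := by
  rw [expNeg_of_ne_top ha, Real.exp_neg]
  have h1 := Real.add_one_le_exp a.toReal
  have h2 := Real.exp_pos a.toReal
  rw [← sub_nonneg]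
  have : 1 - (Real.exp a.toReal)⁻¹ - a.toReal * (Real.exp a.toReal)⁻¹ =
      (Real.exp a.toReal - (a.toReal + 1)) * (Real.exp a.toReal)⁻¹ := by
    field_simp; ring
  rw [this]
  exact mul_nonneg (sub_nonneg.2 h1) (inv_pos.2 h2).le

lemma discount_eq {c : Rd d → ℝ} {ω : CadlagPath d} {s : ℝ≥0∞} (hs : s ≤ innerExit D ω) :
    discount c ω s = expNeg (occ (zeroExt D c) ω s) := by
  have : cumul c ω s = occ (zeroExt D c) ω s :=
    occ_congr_on (f := fun z => ENNReal.ofReal (c z)) (fun z hz => (zeroExt_of_mem hz).symm) hs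
  rw [discount, this, expNeg]

lemma occ_zeroExt_le {c : Rd d → ℝ} {C : ℝ} (hC0 : 0 ≤ C) (hC : ∀ x ∈ D, c x ≤ C)
    {ω : CadlagPath d} {s t : ℝ≥0} (hs : (s : ℝ≥0∞) ≤ innerExit D ω) (hst : s ≤ t) :
    occ (zeroExt D c) ω s ≤ ENNReal.ofReal (C * t) := by
  refine (occ_le_of_le (C := ENNReal.ofReal C) (fun z hz => ?_) hs).trans ?_
  · rw [zeroExt_of_mem hz]
    exact ENNReal.ofReal_le_ofReal (hC z hz)
  · rw [ENNReal.ofReal_mul hC0, ENNReal.ofReal_coe_nnreal]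
    gcongr

variable {A : LevyOp d} {P : Kernel (Rd d) (CadlagPath d)} {c : Rd d → ℝ}

lemma IsStrongMarkovSolution.isMarkovKernel (hP : IsStrongMarkovSolution A P) : IsMarkovKernel P :=
  ⟨fun x => (hP.solution x).prob⟩

lemma IsMartingaleSolution.ae_eval_zero {x : Rd d} {μ : Measure (CadlagPath d)}
    (h : IsMartingaleSolution A (Measure.dirac x) μ) : ∀ᵐ ω ∂μ, ω 0 = x := by
  have h1 : ∀ᵐ z ∂(μ.map fun ω => ω 0), z = x := by
    rw [h.initial, ae_dirac_eq]; rfl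
  exact ae_of_ae_map (measurable_eval 0).aemeasurable h1

lemma IsStrongMarkovSolution.exitTime_ae_eq (hP : IsStrongMarkovSolution A P) (hD : IsOpen D)
    {x : Rd d} (hx : x ∈ D) : exitTime D =ᵐ[P x] innerExit D :=
  (hP.solution x).exitTime_ae_eq hD ((hP.solution x).ae_eval_zero.mono fun _ h => h ▸ hx)

lemma measurable_expNeg_occ {f : Rd d → ℝ≥0∞} (hf : Measurable f) :
    Measurable fun p : CadlagPath d × ℝ≥0∞ => expNeg (occ f p.1 p.2) :=
  measurable_expNeg.comp (measurable_occ hf)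

lemma measurable_expNeg_innerExit {f : Rd d → ℝ≥0∞} (hf : Measurable f) :
    Measurable fun ω => expNeg (occ f ω (innerExit D ω)) :=
  (measurable_expNeg_occ hf).comp (measurable_id.prodMk measurable_innerExit)

lemma gaugeFn_eq (hP : IsStrongMarkovSolution A P) (hD : IsOpen D) {x : Rd d} (hx : x ∈ D) :
    gaugeFn P D c x = ∫ ω, expNeg (occ (zeroExt D c) ω (innerExit D ω)) ∂(P x) := by
  refine integral_congr_ae ?_
  filter_upwards [hP.exitTime_ae_eq hD hx] with ω hω
  rw [hω, discount_eq le_rfl]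

lemma integrable_expNeg_innerExit [IsMarkovKernel P] {f : Rd d → ℝ≥0∞} (hf : Measurable f)
    (x : Rd d) : Integrable (fun ω => expNeg (occ f ω (innerExit D ω))) (P x) :=
  Integrable.of_bound (measurable_expNeg_innerExit hf).aestronglyMeasurable 1
    (Eventually.of_forall fun ω => by
      rw [Real.norm_eq_abs, abs_of_nonneg (expNeg_nonneg _)]; exact expNeg_le_one _)

lemma gaugeFn_le_one (hP : IsStrongMarkovSolution A P) (hD : IsOpen D) (hc : BorelOn D c) {x : Rd d}
    (hx : x ∈ D) : gaugeFn P D c x ≤ 1 := by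
  have := hP.isMarkovKernel
  rw [gaugeFn_eq hP hD hx]
  have h1 := integral_mono
    (integrable_expNeg_innerExit (P := P) (D := D) (measurable_zeroExt hD.measurableSet hc) x)
    (integrable_const 1) fun ω => expNeg_le_one _
  simpa using h1

lemma gaugeFn_pos (hP : IsStrongMarkovSolution A P) (hD : IsOpen D) (hET : CondET P D)
    (hc : IsBbPlus D c) {x : Rd d} (hx : x ∈ D) : 0 < gaugeFn P D c x := by
  have := hP.isMarkovKernel
  obtain ⟨C, hC⟩ := hc.2.2
  rw [gaugeFn_eq hP hD hx, integral_pos_iff_support_of_nonneg (fun ω => expNeg_nonneg _)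
    (integrable_expNeg_innerExit (measurable_zeroExt hD.measurableSet hc.1) x)]
  have hae : ∀ᵐ ω ∂(P x), ω ∈ Function.support
      fun ω => expNeg (occ (zeroExt D c) ω (innerExit D ω)) := by
    filter_upwards [hP.exitTime_ae_eq hD hx, hET x hx] with ω h1 h2
    rw [h1] at h2
    refine (expNeg_pos ?_).ne'
    lift innerExit D ω to ℝ≥0 using h2.ne with s hs
    refine ne_top_of_le_ne_top ?_ (occ_zeroExt_le (le_max_right C 0)
      (fun y hy => (hC y hy).trans (le_max_left _ _)) hs.le (le_refl s))
    exact ENNReal.ofReal_ne_top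
  have h1 : P x (Function.support fun ω => expNeg (occ (zeroExt D c) ω (innerExit D ω))) =
      P x Set.univ := measure_congr (eventuallyEq_univ.2 hae)
  rw [h1]
  simp

lemma borelOn_gaugeFn (hP : IsStrongMarkovSolution A P) (hD : IsOpen D) (hc : BorelOn D c) :
    BorelOn D (gaugeFn P D c) := by
  have := hP.isMarkovKernel
  have h1 : Measurable fun x =>
      ∫ ω, expNeg (occ (zeroExt D c) ω (innerExit D ω)) ∂(P x) := by
    refine StronglyMeasurable.measurable ?_
    exact MeasureTheory.StronglyMeasurable.integral_kernel
      (measurable_expNeg_innerExit (measurable_zeroExt hD.measurableSet hc)).stronglyMeasurable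
  have h2 : (fun x : D => gaugeFn P D c x) = fun x : D =>
      ∫ ω, expNeg (occ (zeroExt D c) ω (innerExit D ω)) ∂(P x) :=
    funext fun x => gaugeFn_eq hP hD x.2
  unfold BorelOn
  rw [h2]
  exact h1.comp measurable_subtype_coe

/-! ### Lower bounds for the deficit of a weak subsolution -/

variable {g u : Rd d → ℝ}

/-- The deficit of a weak subsolution is at least the expected deficit of its stopped discounted
value plus the contribution of the source. -/
lemma IsWeakSubsolution.deficit_ge (hP : IsStrongMarkovSolution A P) (hD : IsOpen D)
    (hc : IsBbPlus D c) (hA2 : A.CondA2) (hu : IsWeakSubsolution P D c g u)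
    (hS : 0 ≤ A.supDS D u) {x : Rd d} (hx : x ∈ D) (t : ℝ≥0) :
    ∫⁻ ω, ENNReal.ofReal (A.supDS D u -
        expNeg (occ (zeroExt D c) ω (capTime (innerExit D ω) t)) *
          u (ω (capTime (innerExit D ω) t))) ∂(P x) +
      sourceMean P D c (fun y => max (-g y) 0) x t ≤ ENNReal.ofReal (A.supDS D u - u x) := by
  have := hP.isMarkovKernel
  set V : CadlagPath d → ℝ := fun ω =>
    expNeg (occ (zeroExt D c) ω (capTime (innerExit D ω) t)) *
      u (ω (capTime (innerExit D ω) t)) with hV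
  have hcapm : Measurable fun ω : CadlagPath d => capTime (innerExit D ω) t :=
    (isOptionalTime_innerExit t).measurable
  have hVm : Measurable V :=
    ((measurable_expNeg_occ (measurable_zeroExt hD.measurableSet hc.1)).comp
      (measurable_id.prodMk hcapm.coe_nnreal_ennreal)).mul
      (hu.measurable.comp (measurable_eval_at hcapm))
  obtain ⟨K, hK⟩ := hu.bounded
  have hVi : Integrable V (P x) := Integrable.of_bound hVm.aestronglyMeasurable K
    (Eventually.of_forall fun ω => by
      rw [hV, norm_mul, Real.norm_eq_abs, Real.norm_eq_abs, abs_of_nonneg (expNeg_nonneg _)]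
      exact (mul_le_of_le_one_left (abs_nonneg _) (expNeg_le_one _)).trans (hK _))
  have hmean : stoppedMean P D c u x t = ∫ ω, V ω ∂(P x) := by
    refine integral_congr_ae ?_
    filter_upwards [hP.exitTime_ae_eq hD hx] with ω hω
    have : exitTimeMin D ω t = capTime (innerExit D ω) t := by rw [← hω]; rfl
    rw [this, discount_eq (D := D) (coe_capTime_le _ _)]
  have hVle : ∀ᵐ ω ∂(P x), V ω ≤ A.supDS D u := by
    filter_upwards [(hP.solution x).apply_eval_innerExit_le hD hA2 hx hu.measurable hu.bounded t]
      with ω hω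
    refine (mul_le_mul_of_nonneg_left hω (expNeg_nonneg _)).trans ?_
    exact mul_le_of_le_one_left hS (expNeg_le_one _)
  have hle := hu.le x hx t
  rw [hmean] at hle
  set s := sourceMean P D c (fun y => max (-g y) 0) x t with hs
  -- An infinite source term would make the right-hand side of the subsolution inequality `-∞`.
  have hs_fin : s ≠ ⊤ := by
    intro h
    rw [h, EReal.coe_ennreal_top, EReal.sub_top, le_bot_iff] at hle
    exact EReal.coe_ne_bot _ hle
  have hsu : s.toReal ≤ ∫ ω, V ω ∂(P x) - u x := by
    rw [← ENNReal.ofReal_toReal hs_fin, EReal.coe_ennreal_ofReal,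
      max_eq_left ENNReal.toReal_nonneg, ← EReal.coe_sub, EReal.coe_le_coe_iff] at hle
    linarith
  have hint : ∫ ω, (A.supDS D u - V ω) ∂(P x) = A.supDS D u - ∫ ω, V ω ∂(P x) := by
    rw [integral_sub (integrable_const _) hVi]; simp
  have hnn : 0 ≤ᵐ[P x] fun ω => A.supDS D u - V ω := hVle.mono fun ω h => sub_nonneg.2 h
  have hlint : ∫⁻ ω, ENNReal.ofReal (A.supDS D u - V ω) ∂(P x) =
      ENNReal.ofReal (∫ ω, (A.supDS D u - V ω) ∂(P x)) :=
    (ofReal_integral_eq_lintegral_ofReal ((integrable_const _).sub hVi) hnn).symm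
  rw [hlint, ← ENNReal.ofReal_toReal hs_fin, ← ENNReal.ofReal_add (integral_nonneg_of_ae hnn)
      ENNReal.toReal_nonneg]
  refine ENNReal.ofReal_le_ofReal ?_
  rw [hint]
  linarith

variable {C : ℝ}

lemma exp_le_expNeg_occ (hC0 : 0 ≤ C) (hC : ∀ x ∈ D, c x ≤ C) (ω : CadlagPath d) {s t : ℝ≥0}
    (hs : (s : ℝ≥0∞) ≤ innerExit D ω) (hst : s ≤ t) :
    Real.exp (-(C * t)) ≤ expNeg (occ (zeroExt D c) ω s) :=
  le_expNeg (by positivity) (occ_zeroExt_le hC0 hC hs hst)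

lemma le_sourceMean (hP : IsStrongMarkovSolution A P) (hD : IsOpen D) (hC0 : 0 ≤ C)
    (hC : ∀ x ∈ D, c x ≤ C) {x : Rd d} (hx : x ∈ D) (t : ℝ≥0) :
    ENNReal.ofReal (Real.exp (-(C * t))) *
        ∫⁻ ω, occ (zeroExt D fun y => max (-g y) 0) ω (capTime (innerExit D ω) t) ∂(P x) ≤
      sourceMean P D c (fun y => max (-g y) 0) x t := by
  rw [← lintegral_const_mul' _ _ ENNReal.ofReal_ne_top]
  refine lintegral_mono_ae ?_
  filter_upwards [hP.exitTime_ae_eq hD hx] with ω hω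
  have hcap : exitTimeMin D ω t = capTime (innerExit D ω) t := by rw [← hω]; rfl
  rw [hcap, occ, ← lintegral_const_mul' _ _ ENNReal.ofReal_ne_top]
  refine setLIntegral_mono' (measurableSet_timesBefore _) fun r hr => ?_
  have hrT := hr.2.le.trans (coe_capTime_le (innerExit D ω) t)
  have hrt : r.toNNReal ≤ t := by
    have : ENNReal.ofReal r ≤ t := hr.2.le.trans (by exact_mod_cast capTime_le (innerExit D ω) t)
    exact ENNReal.coe_le_coe.1 this
  rw [zeroExt_of_mem (eval_mem_of_timesBefore (coe_capTime_le _ t) hr), discount_eq (D := D) hrT,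
    ← ENNReal.ofReal_mul (Real.exp_pos _).le]
  refine ENNReal.ofReal_le_ofReal (mul_le_mul_of_nonneg_right ?_ (le_max_right _ _))
  exact exp_le_expNeg_occ hC0 hC ω hrT hrt

/-- The deficit dominates the discounted occupation integral of `c` times the supremum plus the
negative part of `g`. -/
lemma IsWeakSubsolution.occ_le_deficit (hP : IsStrongMarkovSolution A P) (hD : IsOpen D)
    (hc : IsBbPlus D c) (hC0 : 0 ≤ C) (hC : ∀ x ∈ D, c x ≤ C) (hA2 : A.CondA2)
    (hu : IsWeakSubsolution P D c g u) (hS : 0 ≤ A.supDS D u) {x : Rd d} (hx : x ∈ D) (t : ℝ≥0) :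
    ENNReal.ofReal (Real.exp (-(C * t))) * ∫⁻ ω, occ (fun y => ENNReal.ofReal (A.supDS D u) *
        zeroExt D c y + zeroExt D (fun y => max (-g y) 0) y) ω (capTime (innerExit D ω) t) ∂(P x) ≤
      ENNReal.ofReal (A.supDS D u - u x) := by
  have := hP.isMarkovKernel
  refine le_trans ?_ (hu.deficit_ge hP hD hc hA2 hS hx t)
  have hcm := measurable_zeroExt hD.measurableSet hc.1
  have hcapm : Measurable fun ω : CadlagPath d => ((capTime (innerExit D ω) t : ℝ≥0) : ℝ≥0∞) :=
    (isOptionalTime_innerExit t).measurable.coe_nnreal_ennreal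
  have hoccm : Measurable fun ω => occ (zeroExt D c) ω (capTime (innerExit D ω) t) :=
    (measurable_occ hcm).comp (measurable_id.prodMk hcapm)
  have hsplit : ∀ ω : CadlagPath d, occ (fun y => ENNReal.ofReal (A.supDS D u) *
        zeroExt D c y + zeroExt D (fun y => max (-g y) 0) y) ω (capTime (innerExit D ω) t) =
      ENNReal.ofReal (A.supDS D u) * occ (zeroExt D c) ω (capTime (innerExit D ω) t) +
        occ (zeroExt D fun y => max (-g y) 0) ω (capTime (innerExit D ω) t) := by
    intro ω
    have hm : Measurable fun r : ℝ => zeroExt D c (ω r.toNNReal) :=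
      measurable_comp_eval hcm measurable_const measurable_id
    simp only [occ]
    rw [lintegral_add_left (hm.const_mul _), lintegral_const_mul _ hm]
  simp only [hsplit]
  rw [lintegral_add_left (hoccm.const_mul _), mul_add]
  refine add_le_add ?_ (le_sourceMean hP hD hC0 hC hx t)
  rw [← lintegral_const_mul' _ _ ENNReal.ofReal_ne_top]
  refine lintegral_mono_ae ?_
  filter_upwards [(hP.solution x).apply_eval_innerExit_le hD hA2 hx hu.measurable hu.bounded t]
    with ω hω
  set a := occ (zeroExt D c) ω (capTime (innerExit D ω) t) with ha
  have hat : a ≠ ⊤ := ne_top_of_le_ne_top ENNReal.ofReal_ne_top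
    (occ_zeroExt_le hC0 hC (coe_capTime_le _ t) (capTime_le _ t))
  rw [← ENNReal.ofReal_toReal hat, ← ENNReal.ofReal_mul hS,
    ← ENNReal.ofReal_mul (Real.exp_pos _).le, ENNReal.ofReal_toReal hat]
  refine ENNReal.ofReal_le_ofReal ?_
  have h1 := exp_le_expNeg_occ hC0 hC ω (coe_capTime_le (innerExit D ω) t) (capTime_le _ t)
  have h2 := mul_expNeg_le hat
  calc Real.exp (-(C * t)) * (A.supDS D u * a.toReal)
      ≤ expNeg a * (A.supDS D u * a.toReal) := by gcongr
    _ = A.supDS D u * (a.toReal * expNeg a) := by ring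
    _ ≤ A.supDS D u * (1 - expNeg a) := by gcongr
    _ = A.supDS D u - expNeg a * A.supDS D u := by ring
    _ ≤ _ := by gcongr; exact expNeg_nonneg _

/-- The deficit dominates its discounted expectation along the killed process. -/
lemma IsWeakSubsolution.killed_le_deficit (hP : IsStrongMarkovSolution A P) (hD : IsOpen D)
    (hc : IsBbPlus D c) (hC0 : 0 ≤ C) (hC : ∀ x ∈ D, c x ≤ C) (hA2 : A.CondA2)
    (hu : IsWeakSubsolution P D c g u) (hS : 0 ≤ A.supDS D u) {x : Rd d} (hx : x ∈ D) (t : ℝ≥0) :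
    ENNReal.ofReal (Real.exp (-(C * t))) * ∫⁻ ω, {ω | (t : ℝ≥0∞) < innerExit D ω}.indicator
        (fun ω => ENNReal.ofReal (A.supDS D u - u (ω t))) ω ∂(P x) ≤
      ENNReal.ofReal (A.supDS D u - u x) := by
  refine le_trans ?_ (le_self_add.trans (hu.deficit_ge hP hD hc hA2 hS hx t))
  rw [← lintegral_const_mul' _ _ ENNReal.ofReal_ne_top]
  refine lintegral_mono fun ω => ?_
  by_cases hω : (t : ℝ≥0∞) < innerExit D ω
  · rw [Set.indicator_of_mem (show ω ∈ {ω | (t : ℝ≥0∞) < innerExit D ω} from hω),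
      capTime_of_le hω.le, ← ENNReal.ofReal_mul (Real.exp_pos _).le]
    refine ENNReal.ofReal_le_ofReal ?_
    set e := expNeg (occ (zeroExt D c) ω t)
    have h1 : Real.exp (-(C * t)) ≤ e := exp_le_expNeg_occ hC0 hC ω hω.le le_rfl
    have h2 : 0 ≤ A.supDS D u - u (ω t) :=
      sub_nonneg.2 (le_supDS hu.bounded (Or.inr (mem_of_lt_innerExit hω)))
    calc Real.exp (-(C * t)) * (A.supDS D u - u (ω t)) ≤ e * (A.supDS D u - u (ω t)) := by gcongr
      _ = e * A.supDS D u - e * u (ω t) := by ring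
      _ ≤ A.supDS D u - e * u (ω t) := by
        gcongr
        exact mul_le_of_le_one_left hS (expNeg_le_one _)
  · rw [Set.indicator_of_notMem (show ω ∉ {ω | (t : ℝ≥0∞) < innerExit D ω} from hω), mul_zero]
    exact zero_le

lemma lintegral_exp_mul_le {F : ℝ → ℝ≥0∞} {w : ℝ≥0∞}
    (h : ∀ t : ℝ, 0 ≤ t → ENNReal.ofReal (Real.exp (-(C * t))) * F t ≤ w) :
    ∫⁻ t in Set.Ici (0 : ℝ), ENNReal.ofReal (Real.exp (-(C + 1) * t)) * F t ≤ w := by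
  calc ∫⁻ t in Set.Ici (0 : ℝ), ENNReal.ofReal (Real.exp (-(C + 1) * t)) * F t
      ≤ ∫⁻ t in Set.Ici (0 : ℝ), ENNReal.ofReal (Real.exp (-1 * t)) * w := by
        refine setLIntegral_mono' measurableSet_Ici fun t ht => ?_
        have : Real.exp (-(C + 1) * t) = Real.exp (-1 * t) * Real.exp (-(C * t)) := by
          rw [← Real.exp_add]; ring_nf
        rw [this, ENNReal.ofReal_mul (Real.exp_pos _).le, mul_assoc]
        gcongr
        exact h t ht
    _ = w := by
        rw [lintegral_mul_const _ (measurable_ofReal_exp 1), lintegral_exp_neg, one_mul]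

/-- The deficit of a weak subsolution is superharmonic for the killed resolvent. -/
lemma IsWeakSubsolution.lintegral_deficit_le (hP : IsStrongMarkovSolution A P) (hD : IsOpen D)
    (hc : IsBbPlus D c) (hC0 : 0 ≤ C) (hC : ∀ x ∈ D, c x ≤ C) (hA2 : A.CondA2)
    (hu : IsWeakSubsolution P D c g u) (hS : 0 ≤ A.supDS D u) {x : Rd d} (hx : x ∈ D) :
    ∫⁻ y, ENNReal.ofReal (A.supDS D u - u y) ∂(killedKernel P D (C + 1) x) ≤
      ENNReal.ofReal (A.supDS D u - u x) := by
  have := hP.isMarkovKernel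
  have hwm : Measurable fun y => ENNReal.ofReal (A.supDS D u - u y) :=
    ENNReal.measurable_ofReal.comp (measurable_const.sub hu.measurable)
  rw [lintegral_killedKernel_swap _ hwm]
  refine lintegral_exp_mul_le fun t ht => ?_
  have := hu.killed_le_deficit hP hD hc hC0 hC hA2 hS hx t.toNNReal
  rwa [Real.coe_toNNReal t ht] at this

/-- The deficit of a weak subsolution dominates a multiple of the killed resolvent applied to the
combined zero-order and source terms. -/
lemma IsWeakSubsolution.lintegral_source_le (hP : IsStrongMarkovSolution A P) (hD : IsOpen D)
    (hc : IsBbPlus D c) (hC0 : 0 ≤ C) (hC : ∀ x ∈ D, c x ≤ C) (hA2 : A.CondA2) (hg : BorelOn D g)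
    (hu : IsWeakSubsolution P D c g u) (hS : 0 ≤ A.supDS D u) {x : Rd d} (hx : x ∈ D) :
    ENNReal.ofReal (Real.exp (-(C + 1))) * ∫⁻ y, (ENNReal.ofReal (A.supDS D u) *
        zeroExt D c y + zeroExt D (fun y => max (-g y) 0) y) ∂(killedKernel P D (C + 1) x) ≤
      ENNReal.ofReal (A.supDS D u - u x) := by
  have := hP.isMarkovKernel
  have hgm : BorelOn D fun y => max (-g y) 0 := hg.neg.max measurable_const
  refine (killedKernel_le_lintegral_occ (by positivity) (((measurable_zeroExt hD.measurableSet
    hc.1).const_mul _).add (measurable_zeroExt hD.measurableSet hgm)) x).trans ?_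
  refine lintegral_exp_mul_le fun t ht => ?_
  have := hu.occ_le_deficit hP hD hc hC0 hC hA2 hS hx t.toNNReal
  rwa [Real.coe_toNNReal t ht] at this

/-! ### The quantitative Hopf lemma -/

/-- Irreducibility of the resolvent says that the killed kernels dominate the reference measure,
at every discount rate. -/
lemma absolutelyContinuous_killedKernel (hP : IsStrongMarkovSolution A P) (hD : IsOpen D)
    {m : Measure (Rd d)} (hIR : CondIR P D m) (α : ℝ) {x : Rd d} (hx : x ∈ D) :
    m.restrict D ≪ killedKernel P D α x := by
  have := hP.isMarkovKernel
  refine Measure.AbsolutelyContinuous.mk fun S hS h0 => ?_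
  by_contra hne
  have hind : Measurable (S.indicator fun _ => (1 : ℝ)) := measurable_const.indicator hS
  have hpos := hIR (S.indicator fun _ => 1)
    ⟨hind.comp measurable_subtype_coe, fun y _ => Set.indicator_nonneg (fun _ _ => zero_le_one) y,
      1, fun y _ => Set.indicator_le_self' (fun _ _ => zero_le_one) y⟩ ?_ x hx
  swap
  · have : ∀ y, ENNReal.ofReal (S.indicator (fun _ => (1 : ℝ)) y) = S.indicator 1 y := fun y => by
      by_cases hy : y ∈ S <;> simp [hy]
    simp only [this]
    rw [lintegral_indicator_one hS]
    exact pos_iff_ne_zero.2 hne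
  refine hpos.ne' ?_
  have hSm : Measurable (S.indicator (1 : Rd d → ℝ≥0∞)) := measurable_one.indicator hS
  -- The weights `e^{-α t}` and `e^{-t}` are positive, so the two resolvents have the same null sets.
  have h1 : ∫⁻ y, S.indicator (1 : Rd d → ℝ≥0∞) y ∂(killedKernel P D α x) = 0 := by
    rw [lintegral_indicator_one hS, h0]
  rw [lintegral_killedKernel α hSm] at h1
  have hm : Measurable fun ω : CadlagPath d =>
      ∫⁻ t in {t : ℝ | 0 ≤ t ∧ ENNReal.ofReal t < innerExit D ω},
        ENNReal.ofReal (Real.exp (-α * t)) * S.indicator (1 : Rd d → ℝ≥0∞) (ω t.toNNReal) :=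
    (measurable_lintegral_timesBefore (((measurable_ofReal_exp α).comp measurable_snd).mul
      (measurable_comp_eval hSm measurable_fst measurable_snd))).comp
      (measurable_id.prodMk measurable_innerExit)
  rw [lintegral_eq_zero_iff hm] at h1
  rw [resolventD]
  refine (lintegral_congr_ae ?_).trans lintegral_zero
  filter_upwards [h1, hP.exitTime_ae_eq hD hx] with ω hω hτ
  have hfm : Measurable fun t : ℝ => ENNReal.ofReal (Real.exp (-α * t)) *
      S.indicator (1 : Rd d → ℝ≥0∞) (ω t.toNNReal) :=
    (measurable_ofReal_exp α).mul (measurable_comp_eval hSm measurable_const measurable_id)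
  rw [hτ]
  have hω' := (lintegral_eq_zero_iff hfm).1 hω
  refine (lintegral_congr_ae ?_).trans lintegral_zero
  filter_upwards [hω'] with t ht
  have hexp : ENNReal.ofReal (Real.exp (-α * t)) ≠ 0 :=
    (ENNReal.ofReal_pos.2 (Real.exp_pos _)).ne'
  have h2 : S.indicator (1 : Rd d → ℝ≥0∞) (ω t.toNNReal) = 0 :=
    (mul_eq_zero.1 ht).resolve_left hexp
  have h3 : ω t.toNNReal ∉ S := fun hmem => by
    rw [Set.indicator_of_mem hmem] at h2
    exact one_ne_zero h2
  simp [h3]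

/-- The Hopf bound in terms of a rank-one minorant, with the source and zero-order terms kept
separate. The gauge function enters only through `v ≤ 1`, since the argument in fact bounds the
deficit by the larger quantity with `∫ c dν` in place of `∫ c v dν`. -/
theorem exists_hopf_minorization (hD : IsOpen D) (hA2 : A.CondA2) (hP : IsStrongMarkovSolution A P)
    {m : Measure (Rd d)} [SigmaFinite m] (hm : m D ≠ 0) (hIR : CondIR P D m) (hc : IsBbPlus D c) :
    ∃ (ψ : Rd d → ℝ) (ν : Measure (Rd d)),
      BorelOn D ψ ∧ (∀ x ∈ D, 0 < ψ x) ∧ ν Dᶜ = 0 ∧ m.restrict D ≪ ν ∧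
      ∀ g : Rd d → ℝ, BorelOn D g → ∀ u : Rd d → ℝ, IsWeakSubsolution P D c g u →
      0 ≤ A.supDS D u → ∀ x ∈ D,
        ENNReal.ofReal (ψ x) *
            (ENNReal.ofReal (A.supDS D u) * ∫⁻ y in D, ENNReal.ofReal (c y * gaugeFn P D c y) ∂ν
              + ∫⁻ y in D, ENNReal.ofReal (max (-g y) 0) ∂ν)
          ≤ ENNReal.ofReal (A.supDS D u - u x) := by
  have := hP.isMarkovKernel
  obtain ⟨C', hC'⟩ := hc.2.2
  set C := max C' 0 with hCdef
  have hC0 : 0 ≤ C := le_max_right _ _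
  have hC : ∀ x ∈ D, c x ≤ C := fun x hx => (hC' x hx).trans (le_max_left _ _)
  have hDm := hD.measurableSet
  have : NeZero (m.restrict D) := ⟨fun h => hm (Measure.restrict_eq_zero.1 h)⟩
  have := isFiniteKernel_killedKernel (P := P) (D := D) (α := C + 1) (by positivity)
  obtain ⟨ψ, ν, hψm, hψt, hψ0, hmν, hmin⟩ := exists_minorization (killedKernel P D (C + 1)) hDm
    (m.restrict D).toFinite (toFinite_absolutelyContinuous _ (ae_restrict_mem hDm))
    fun x hx => (toFinite_absolutelyContinuous _).trans
      (absolutelyContinuous_killedKernel hP hD hIR (C + 1) hx)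
  set κ : ℝ≥0∞ := ENNReal.ofReal (Real.exp (-(C + 1))) with hκ
  have hκ0 : 0 < κ := ENNReal.ofReal_pos.2 (Real.exp_pos _)
  have hκt : κ ≠ ⊤ := ENNReal.ofReal_ne_top
  have hfin : ∀ x, κ * ψ x ≠ ⊤ := fun x => ENNReal.mul_ne_top hκt (hψt x)
  refine ⟨fun x => (κ * ψ x).toReal, ν.restrict D, ?_, fun x hx => ?_, ?_, ?_, ?_⟩
  · exact ((hψm.const_mul _).ennreal_toReal).comp measurable_subtype_coe
  · exact ENNReal.toReal_pos (mul_ne_zero hκ0.ne' (hψ0 x hx).ne') (hfin x)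
  · rw [Measure.restrict_apply hDm.compl]; simp
  · have := ((absolutelyContinuous_toFinite (m.restrict D)).trans hmν).restrict D
    rwa [Measure.restrict_restrict hDm, Set.inter_self] at this
  · intro g hg u hu hS x hx
    have hgm : BorelOn D fun y => max (-g y) 0 := hg.neg.max measurable_const
    have hcm := measurable_zeroExt hDm hc.1
    have hhm := (hcm.const_mul (ENNReal.ofReal (A.supDS D u))).add (measurable_zeroExt hDm hgm)
    have hmain := hmin (fun y => κ * (ENNReal.ofReal (A.supDS D u) *
        zeroExt D c y + zeroExt D (fun y => max (-g y) 0) y))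
      (fun y => ENNReal.ofReal (A.supDS D u - u y)) (hhm.const_mul κ)
      (ENNReal.measurable_ofReal.comp (measurable_const.sub hu.measurable))
      (fun y hy => by
        rw [lintegral_const_mul' _ _ hκt]
        exact hu.lintegral_source_le hP hD hc hC0 hC hA2 hg hS hy)
      (fun y hy => hu.lintegral_deficit_le hP hD hc hC0 hC hA2 hS hy) x hx
    refine le_trans ?_ hmain
    rw [ENNReal.ofReal_toReal (hfin x), lintegral_const_mul' _ _ hκt, ← mul_assoc, mul_comm κ,
      lintegral_add_left (hcm.const_mul _), lintegral_const_mul _ hcm,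
      Measure.restrict_restrict hDm, Set.inter_self]
    have h1 : ∫⁻ y in D, ENNReal.ofReal (c y * gaugeFn P D c y) ∂ν ≤ ∫⁻ y, zeroExt D c y ∂ν := by
      rw [zeroExt, lintegral_indicator hDm]
      refine setLIntegral_mono' hDm fun y hy => ENNReal.ofReal_le_ofReal ?_
      exact mul_le_of_le_one_right (hc.2.1 y hy) (gaugeFn_le_one hP hD hc.1 hy)
    have h2 : ∫⁻ y in D, ENNReal.ofReal (max (-g y) 0) ∂ν =
        ∫⁻ y, zeroExt D (fun y => max (-g y) 0) y ∂ν := by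
      rw [zeroExt, lintegral_indicator hDm]
    rw [h2]
    gcongr

lemma lintegral_mul_gaugeFn_pos (hD : IsOpen D) (hP : IsStrongMarkovSolution A P)
    (hET : CondET P D) (hc : IsBbPlus D c) {m ν : Measure (Rd d)} (hmν : m.restrict D ≪ ν)
    (hcm : 0 < ∫⁻ x in D, ENNReal.ofReal (c x) ∂m) :
    0 < ∫⁻ y in D, ENNReal.ofReal (c y * gaugeFn P D c y) ∂ν := by
  have hDm := hD.measurableSet
  have hprod : BorelOn D fun y => c y * gaugeFn P D c y :=
    Measurable.mul hc.1 (borelOn_gaugeFn hP hD hc.1)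
  have hconv : ∫⁻ y in D, ENNReal.ofReal (c y * gaugeFn P D c y) ∂ν =
      ∫⁻ y, zeroExt D (fun y => c y * gaugeFn P D c y) y ∂ν := by
    rw [zeroExt, lintegral_indicator hDm]
  rw [hconv, pos_iff_ne_zero]
  intro h0
  refine hcm.ne' ?_
  have h1 := hmν ((lintegral_eq_zero_iff (measurable_zeroExt hDm hprod)).1 h0)
  refine (lintegral_congr_ae ?_).trans lintegral_zero
  filter_upwards [h1, ae_restrict_mem hDm] with y hy hyD
  have hy : zeroExt D (fun y => c y * gaugeFn P D c y) y = 0 := hy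
  rw [zeroExt_of_mem hyD, ENNReal.ofReal_eq_zero] at hy
  refine ENNReal.ofReal_eq_zero.2 ?_
  by_contra! hpos
  exact hy.not_gt (mul_pos hpos (gaugeFn_pos hP hD hET hc hyD))

end

end NonlocalHopf

theorem theorem3p8 {d : ℕ} (A : LevyOp d) (D : Set (Rd d)) (hD : IsOpen D) (hDc : IsConnected D)
    (hA1 : A.CondA1 D) (hA2 : A.CondA2)
    (P : Kernel (Rd d) (CadlagPath d)) (hA4 : IsStrongMarkovSolution A P) (hET : CondET P D)
    (m : Measure (Rd d)) [SigmaFinite m] (hm : m D ≠ 0) (hIR : CondIR P D m)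
    (c : Rd d → ℝ) (hA3 : IsBbPlus D c) :
    (∃ (ψ : Rd d → ℝ) (ν : Measure (Rd d)),
      BorelOn D ψ ∧ (∀ x ∈ D, 0 < ψ x) ∧ ν Dᶜ = 0 ∧ m.restrict D ≪ ν ∧
      ∀ g : Rd d → ℝ, BorelOn D g → (∀ x ∈ D, g x ≤ 0) →
      ∀ u : Rd d → ℝ, IsWeakSubsolution P D c g u → 0 ≤ A.supDS D u →
      ∀ x ∈ D,
        ENNReal.ofReal (ψ x) *
            (ENNReal.ofReal (A.supDS D u) * ∫⁻ y in D, ENNReal.ofReal (c y * gaugeFn P D c y) ∂ν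
              + ∫⁻ y in D, ENNReal.ofReal (max (-g y) 0) ∂ν)
          ≤ ENNReal.ofReal (A.supDS D u - u x)) ∧
    (0 < ∫⁻ x in D, ENNReal.ofReal (c x) ∂m →
      ∃ ψ : Rd d → ℝ, BorelOn D ψ ∧ (∀ x ∈ D, 0 < ψ x) ∧
        ∀ g : Rd d → ℝ, BorelOn D g → (∀ x ∈ D, g x ≤ 0) → QuantHopf A P D c g ψ) := by
  obtain ⟨ψ, ν, hψ, hψ0, hν, hmν, hmain⟩ := exists_hopf_minorization hD hA2 hA4 hm hIR hA3
  refine ⟨⟨ψ, ν, hψ, hψ0, hν, hmν, fun g hg _ u hu hS => hmain g hg u hu hS⟩, fun hcm => ?_⟩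
  set I := ∫⁻ y in D, ENNReal.ofReal (c y * gaugeFn P D c y) ∂ν with hI
  have hI0 : 0 < I := lintegral_mul_gaugeFn_pos hD hA4 hET hA3 hmν hcm
  -- The truncation only matters if the integral is infinite.
  have hIt : min 1 I ≠ ⊤ := ne_top_of_le_ne_top ENNReal.one_ne_top (min_le_left _ _)
  have hI1 : 0 < (min 1 I).toReal := ENNReal.toReal_pos (lt_min one_pos hI0).ne' hIt
  refine ⟨fun x => ψ x * (min 1 I).toReal, Measurable.mul_const hψ _,
    fun x hx => mul_pos (hψ0 x hx) hI1, fun g hg _ u hu x hx => ?_⟩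
  have hux : u x ≤ A.supDS D u := le_supDS hu.bounded (Or.inr hx)
  have hψx := hψ0 x hx
  rcases le_or_gt 0 (A.supDS D u) with hS | hS
  · refine (ENNReal.ofReal_le_ofReal_iff (sub_nonneg.2 hux)).1 (le_trans ?_ (hmain g hg u hu hS x hx))
    rw [ENNReal.ofReal_mul hS, ENNReal.ofReal_mul hψx.le, ENNReal.ofReal_toReal hIt]
    calc ENNReal.ofReal (A.supDS D u) * (ENNReal.ofReal (ψ x) * min 1 I)
        ≤ ENNReal.ofReal (A.supDS D u) * (ENNReal.ofReal (ψ x) * I) := by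
          gcongr; exact min_le_right _ _
      _ = ENNReal.ofReal (ψ x) * (ENNReal.ofReal (A.supDS D u) * I) := by ring
      _ ≤ _ := by gcongr; exact le_self_add
  · have : A.supDS D u * (ψ x * (min 1 I).toReal) ≤ 0 :=
      mul_nonpos_of_nonpos_of_nonneg hS.le (by positivity)
    linarith
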